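/- Let $q$ be a fixed power of $2$ ($q\ge 2$). Let $U(n,q)$ denote the unitary group, that is, the subgroup of $GL(n,\mathbb{F}_{q^2})$ preserving a nondegenerate Hermitian form on $\mathbb{F}_{q^2}^n$ with respect to the automorphism $x\mapsto x^q$ (any such form; one is chosen for each $n$), and let $i_U(n,q)$ denote the number of involutions in $U(n,q)$, where as usual in such counts the identity is included: $i_U(n,q)=\#\{g\in U(n,q): g^2=1\}$. Then 1. as $n\to\infty$ through even integers, $$\lim_{n\to\infty}\frac{i_U(n,q)}{q^{n^2/2}}=\prod_{k\ge 1}\frac{(1-q^{3-8k})(1-q^{5-8k})(1-q^{-8k})}{1-q^{-2k}};$$ 2. as $n\to\infty$ through odd integers, $$\lim_{n\to\infty}\frac{i_U(n,q)}{q^{(n^2-1)/2}}=\prod_{k\ge 1}\frac{(1-q^{1-8k})(1-q^{7-8k})(1-q^{-8k})}{1-q^{-2k}}.$$ Both infinite products converge. -/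

import Mathlib

open Filter Topology

/-- The sesquilinear form `∑ i j, (x i)^q * H i j * y j` on `K^n` with Gram matrix `H`.
When `K` is a field with `q ^ 2` elements, `a ↦ a ^ q` is the automorphism of order two of `K`. -/
def sesqForm {K : Type*} [Field K] {n : ℕ} (q : ℕ) (H : Matrix (Fin n) (Fin n) K)
    (x y : Fin n → K) : K :=
  ∑ i, ∑ j, x i ^ q * H i j * y j

/-- `H` is the Gram matrix of a nondegenerate Hermitian form on `K^n`, where `K` is a field with
`q ^ 2` elements. -/
structure IsNondegHermitian {K : Type*} [Field K] {n : ℕ} (q : ℕ)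
    (H : Matrix (Fin n) (Fin n) K) : Prop where
  conj_symm : ∀ i j, H i j ^ q = H j i
  nondeg : ∀ x, (∀ y, sesqForm q H x y = 0) → x = 0

/-- The unitary group of the form with Gram matrix `H`: the subgroup of `GL(n, K)` of all elements
that preserve the form. -/
def formUnitaryGroup {K : Type*} [Field K] {n : ℕ} (q : ℕ) (H : Matrix (Fin n) (Fin n) K) :
    Subgroup (GL (Fin n) K) where
  carrier := {g | ∀ x y, sesqForm q H (g.val.mulVec x) (g.val.mulVec y) = sesqForm q H x y}
  one_mem' := by
    intro x y
    simp
  mul_mem' := by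
    intro a b ha hb x y
    have h := ha (b.val.mulVec x) (b.val.mulVec y)
    simp only [Matrix.mulVec_mulVec] at h
    rw [Units.val_mul, h]
    exact hb x y
  inv_mem' := by
    intro a ha x y
    have h := ha ((a⁻¹).val.mulVec x) ((a⁻¹).val.mulVec y)
    simpa only [Matrix.mulVec_mulVec, Units.mul_inv, Matrix.one_mulVec] using h.symm

/-- The number of involutions of a group, that is, of solutions of `g ^ 2 = 1`
(the identity is counted). -/
noncomputable def numInvolutions (G : Type*) [Group G] : ℕ :=
  Nat.card {g : G // g ^ 2 = 1}

/-- The factor `(1 - q^(a-8k)) (1 - q^(b-8k)) (1 - q^(-8k)) / (1 - q^(-2k))`. -/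
noncomputable def limitFactor (q : ℕ) (a b k : ℤ) : ℝ :=
  (1 - (q : ℝ) ^ (a - 8 * k)) * (1 - (q : ℝ) ^ (b - 8 * k)) * (1 - (q : ℝ) ^ (-8 * k)) /
    (1 - (q : ℝ) ^ (-2 * k))

/-!
Let `x = -1/q`, and let `(x)_k = (1 - x)(1 - x²)⋯(1 - x^k)`.

**From involutions to square-zero maps.** In characteristic two, `g ↦ g - 1` is a bijection from
the involutions of the unitary group onto the self-adjoint endomorphisms `N` with `N² = 0`
(`numInvolutions_eq_card`).

**Counting them by rank.** Let `s(n, r)` be the number of such `N` of rank `r` on a nondegenerate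
Hermitian space of dimension `n`. The pairs `(N, v)` with `B(v, Nv) ≠ 0` are counted twice. For
given `N`, the vectors `v` are the anisotropic vectors of the Hermitian form `(x, y) ↦ B(x, Ny)` of
rank `r`, and their number is known (`IsHermitianForm.card_isotropic`, by induction along an
orthogonal splitting). For given `v` and `w = Nv`, the vector `w` is isotropic, `v` and `w` span a
nondegenerate plane that `N` preserves, and `N` is determined by its restriction to the orthogonal
complement, which is an arbitrary self-adjoint square-zero map of rank `r - 1`
(`IsHermitianForm.card_sqZeroOfRank_apply_eq`). With `u_i = q^i - (-1)^i` this gives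
`s(n, r) = q^(r-1) u_n u_(n-1) / u_r · s(n-2, r-1)` (`IsHermitianForm.card_sqZeroOfRank`), hence
`s(n, r) = q^(2r(n-r)) (x)_n / ((x)_(n-2r) (x)_r)` (`sqZeroCount_add`).

**The limit.** Sum over `r = l - s` for `n = 2l + e` with `e ∈ {0, 1}` and divide by the power of
`q`: by dominated convergence the limit is `∑ x^(2s(s+e)) / (x)_(2s+e)` (`tendsto_sqZeroTotal`).

**Slater's identities.** These two sums are the parts even and odd in `y = √x` of Euler's sum
`∑ y^(n²) / (x)_n = ∏ (1 + y x^k)` (`hasSum_pow_mul_pow_div_qPoch`). The product on the right,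
multiplied by `∏ (1 - x^(2k))`, is a theta series by the Jacobi triple product
(`hasSum_jacobi_triple_product`); the even and the odd part of that series are theta series again,
and a second application of the triple product, with `x^8` in place of `x²`, turns them into the
products of the theorem (`slater_identities`). Euler's sum and the triple product are limits of the
`q`-binomial theorem.
-/

/-! ### The `q`-binomial theorem -/

/-- The `q`-Pochhammer symbol `(x; x)_k = ∏_{i=1}^k (1 - x ^ i)`. -/
def qPoch {F : Type*} [Field F] (x : F) (k : ℕ) : F :=
  ∏ i ∈ Finset.range k, (1 - x ^ (i + 1))

@[simp] lemma qPoch_zero {F : Type*} [Field F] (x : F) : qPoch x 0 = 1 := by simp [qPoch]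

lemma qPoch_succ {F : Type*} [Field F] (x : F) (k : ℕ) :
    qPoch x (k + 1) = qPoch x k * (1 - x ^ (k + 1)) := by
  simp [qPoch, Finset.prod_range_succ]

/-- The Gaussian binomial coefficient with parameter `x`, defined by its Pascal recursion. -/
def gaussBinom {F : Type*} [Field F] (x : F) : ℕ → ℕ → F
  | _, 0 => 1
  | 0, _ + 1 => 0
  | N + 1, j + 1 => x ^ (j + 1) * gaussBinom x N (j + 1) + gaussBinom x N j

section Algebra

variable {F : Type*} [Field F] (x : F)

@[simp] lemma gaussBinom_zero_right (N : ℕ) : gaussBinom x N 0 = 1 := by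
  cases N <;> rfl

lemma gaussBinom_succ_succ (N j : ℕ) : gaussBinom x (N + 1) (j + 1) =
    x ^ (j + 1) * gaussBinom x N (j + 1) + gaussBinom x N j := rfl

lemma gaussBinom_eq_zero_of_lt : ∀ {N j : ℕ}, N < j → gaussBinom x N j = 0
  | _, 0, h => absurd h (Nat.not_lt_zero _)
  | 0, _ + 1, _ => rfl
  | N + 1, j + 1, h => by
    rw [gaussBinom_succ_succ, gaussBinom_eq_zero_of_lt (N := N) (j := j + 1) (by omega),
      gaussBinom_eq_zero_of_lt (N := N) (j := j) (by omega), mul_zero, zero_add]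

lemma gaussBinom_self : ∀ N : ℕ, gaussBinom x N N = 1
  | 0 => rfl
  | N + 1 => by
    rw [gaussBinom_succ_succ, gaussBinom_eq_zero_of_lt x (Nat.lt_succ_self N), mul_zero, zero_add,
      gaussBinom_self N]

lemma gaussBinom_mul_qPoch_mul_qPoch (a b : ℕ) :
    gaussBinom x (a + b) a * qPoch x a * qPoch x b = qPoch x (a + b) := by
  induction hs : a + b generalizing a b with
  | zero =>
    obtain ⟨rfl, rfl⟩ : a = 0 ∧ b = 0 := by omega
    simp
  | succ N ih =>
    rcases a with _ | a
    · obtain rfl : b = N + 1 := by omega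
      simp
    rcases b with _ | b
    · obtain rfl : a = N := by omega
      simp [gaussBinom_self]
    have h1 := ih (a + 1) b (by omega)
    have h2 := ih a (b + 1) (by omega)
    have h3 : x ^ (N + 1) = x ^ (a + 1) * x ^ (b + 1) := by rw [← pow_add]; congr 1; omega
    rw [gaussBinom_succ_succ, qPoch_succ x N, h3]
    rw [qPoch_succ] at h1 h2 ⊢
    rw [qPoch_succ]
    linear_combination x ^ (a + 1) * (1 - x ^ (b + 1)) * h1 + (1 - x ^ (a + 1)) * h2

lemma pow_succ_mul_pred (p : F) (j : ℕ) :
    p ^ ((j + 1) * (j + 1 - 1)) = p ^ (j * (j - 1)) * p ^ (2 * j) := by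
  rw [← pow_add]
  congr 1
  rcases j with _ | j
  · rfl
  · simp only [Nat.add_sub_cancel]; ring

/-- The `q`-binomial theorem, with base `p ^ 2`. -/
lemma prod_one_add_mul_pow_eq_sum (p : F) (N : ℕ) (z : F) :
    ∏ i ∈ Finset.range N, (1 + z * p ^ (2 * i)) =
      ∑ j ∈ Finset.range (N + 1), gaussBinom (p ^ 2) N j * p ^ (j * (j - 1)) * z ^ j := by
  induction N generalizing z with
  | zero => simp
  | succ N ih =>
    have h1 : ∏ i ∈ Finset.range N, (1 + z * p ^ (2 * (i + 1))) =
        ∏ i ∈ Finset.range N, (1 + (z * p ^ 2) * p ^ (2 * i)) :=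
      Finset.prod_congr rfl fun i _ => by ring
    rw [Finset.prod_range_succ', h1, ih, Finset.sum_range_succ' _ (N + 1)]
    set t : ℕ → F := fun j => gaussBinom (p ^ 2) N j * p ^ (j * (j - 1)) * (z * p ^ 2) ^ j with ht
    have h3 : ∑ j ∈ Finset.range (N + 1), t j = ∑ j ∈ Finset.range (N + 1), t (j + 1) + 1 := by
      have h4 : ∑ j ∈ Finset.range (N + 1 + 1), t j = ∑ j ∈ Finset.range (N + 1), t j := by
        rw [Finset.sum_range_succ, ht]
        simp [gaussBinom_eq_zero_of_lt _ (Nat.lt_succ_self N)]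
      rw [← h4, Finset.sum_range_succ']
      simp [ht]
    have h5 : ∀ j, gaussBinom (p ^ 2) (N + 1) (j + 1) * p ^ ((j + 1) * (j + 1 - 1)) * z ^ (j + 1) =
        t (j + 1) + z * t j := by
      intro j
      simp only [ht, gaussBinom_succ_succ, pow_succ_mul_pred]
      ring
    simp only [h5, Finset.sum_add_distrib, ← Finset.mul_sum]
    rw [mul_add, mul_one, Nat.mul_zero, pow_zero, mul_one]
    conv_lhs => rw [add_comm, mul_comm]
    rw [h3]
    simp
    ring

/-- The `q`-binomial theorem with `2 N` factors, centred so that it becomes an identity between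
Laurent polynomials in `z`: a finite form of the Jacobi triple product. -/
lemma prod_mul_prod_eq_sum_zpow {p z : F} (hp : p ≠ 0) (hz : z ≠ 0) (N : ℕ) :
    (∏ i ∈ Finset.range N, (1 + z * p ^ (2 * i))) *
        ∏ i ∈ Finset.range N, (1 + z⁻¹ * p ^ (2 * i + 2)) =
      ∑ j ∈ Finset.range (2 * N + 1), gaussBinom (p ^ 2) (2 * N) j *
        (p ^ (((j : ℤ) - N) * ((j : ℤ) - N - 1)) * z ^ ((j : ℤ) - N)) := by
  have hrefl : ∀ N : ℕ, ∏ i ∈ Finset.range N, (1 + z * (p ^ (2 * N))⁻¹ * p ^ (2 * i)) =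
      z ^ N * (p ^ (N * (N + 1)))⁻¹ * ∏ i ∈ Finset.range N, (1 + z⁻¹ * p ^ (2 * i + 2)) := by
    intro N
    induction N with
    | zero => simp
    | succ N ih =>
      rw [Finset.prod_range_succ', Finset.prod_range_succ]
      have : ∀ i, 1 + z * (p ^ (2 * (N + 1)))⁻¹ * p ^ (2 * (i + 1)) =
          1 + z * (p ^ (2 * N))⁻¹ * p ^ (2 * i) := by
        intro i
        field_simp
        ring
      simp only [this]
      rw [ih]
      have : 1 + z * (p ^ (2 * (N + 1)))⁻¹ * p ^ (2 * 0) =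
          z * (p ^ (2 * (N + 1)))⁻¹ * (1 + z⁻¹ * p ^ (2 * N + 2)) := by
        field_simp
        ring
      rw [this]
      have : (p ^ ((N + 1) * (N + 1 + 1)))⁻¹ = (p ^ (N * (N + 1)))⁻¹ * (p ^ (2 * (N + 1)))⁻¹ := by
        rw [← mul_inv, ← pow_add]
        congr 2
        ring
      rw [this]
      ring
  -- The shift `z ↦ z p^(-2N)` moves the middle of the `2 N` factors to `i = 0`.
  have h := prod_one_add_mul_pow_eq_sum p (2 * N) (z * (p ^ (2 * N))⁻¹)
  rw [two_mul N, Finset.prod_range_add, ← two_mul, hrefl] at h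
  have h1 : ∏ i ∈ Finset.range N, (1 + z * (p ^ (2 * N))⁻¹ * p ^ (2 * (N + i))) =
      ∏ i ∈ Finset.range N, (1 + z * p ^ (2 * i)) :=
    Finset.prod_congr rfl fun i _ => by
      rw [mul_add, pow_add]
      field_simp
  rw [h1] at h
  have hc : z ^ N * (p ^ (N * (N + 1)))⁻¹ ≠ 0 :=
    mul_ne_zero (pow_ne_zero _ hz) (inv_ne_zero (pow_ne_zero _ hp))
  apply mul_left_cancel₀ hc
  calc _ = _ := by rw [mul_comm (∏ i ∈ Finset.range N, _), ← mul_assoc]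
    _ = _ := h
    _ = _ := by
      rw [Finset.mul_sum]
      refine Finset.sum_congr rfl fun j _ => ?_
      have e1 : p ^ (j * (j - 1)) = p ^ ((j : ℤ) * (j - 1)) := by
        rw [← zpow_natCast]
        congr 1
        rcases j with _ | j <;> simp
      have e2 : (z * (p ^ (2 * N))⁻¹) ^ j = z ^ (j : ℤ) * p ^ (-(2 * N * j : ℤ)) := by
        rw [mul_pow, zpow_natCast, zpow_neg, ← inv_pow, ← pow_mul, inv_pow]
        norm_cast
      have e3 : z ^ N * (p ^ (N * (N + 1)))⁻¹ = z ^ (N : ℤ) * p ^ (-(N * (N + 1) : ℤ)) := by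
        rw [zpow_natCast, zpow_neg]
        norm_cast
      rw [e1, e2, e3]
      have e4 : z ^ (j : ℤ) = z ^ (N : ℤ) * z ^ ((j : ℤ) - N) := by
        rw [← zpow_add₀ hz]; congr 1; ring
      have e5 : p ^ ((j : ℤ) * (j - 1)) * p ^ (-(2 * N * j : ℤ)) =
          p ^ (-(N * (N + 1) : ℤ)) * p ^ (((j : ℤ) - N) * ((j : ℤ) - N - 1)) := by
        rw [← zpow_add₀ hp, ← zpow_add₀ hp]; congr 1; ring
      rw [e4]
      linear_combination gaussBinom (p ^ 2) (2 * N) j * z ^ (N : ℤ) * z ^ ((j : ℤ) - N) * e5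

end Algebra

/-! ### Euler's sum and the Jacobi triple product -/

section Limits

variable {𝕜 : Type*} [NormedField 𝕜]

lemma summable_norm_mul_pow_linear {x : 𝕜} (hx : ‖x‖ < 1) (c : 𝕜) {a : ℕ} (ha : 0 < a) (b : ℕ) :
    Summable fun k : ℕ => ‖c * x ^ (a * k + b)‖ := by
  have h : ‖x‖ ^ a < 1 := pow_lt_one₀ (norm_nonneg _) hx ha.ne'
  refine ((summable_geometric_of_lt_one (by positivity) h).mul_left (‖c‖ * ‖x‖ ^ b)).congr ?_
  intro k
  rw [norm_mul, norm_pow, pow_add, pow_mul]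
  ring

lemma one_sub_pow_ne_zero {x : 𝕜} (hx : ‖x‖ < 1) {k : ℕ} (hk : k ≠ 0) : 1 - x ^ k ≠ 0 := by
  intro h
  have h1 : ‖x ^ k‖ = 1 := by rw [← sub_eq_zero.1 h, norm_one]
  rw [norm_pow] at h1
  exact (pow_lt_one₀ (norm_nonneg _) hx hk).ne h1

lemma qPoch_ne_zero {x : 𝕜} (hx : ‖x‖ < 1) (k : ℕ) : qPoch x k ≠ 0 :=
  Finset.prod_ne_zero_iff.2 fun _ _ => one_sub_pow_ne_zero hx (Nat.succ_ne_zero _)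

lemma gaussBinom_eq_div {x : 𝕜} (hx : ‖x‖ < 1) {N j : ℕ} (h : j ≤ N) :
    gaussBinom x N j = qPoch x N / (qPoch x j * qPoch x (N - j)) := by
  have := gaussBinom_mul_qPoch_mul_qPoch x j (N - j)
  rw [Nat.add_sub_cancel' h] at this
  rw [eq_div_iff (mul_ne_zero (qPoch_ne_zero hx _) (qPoch_ne_zero hx _)), ← this]
  ring

lemma summable_norm_pow_mul_pow {p : 𝕜} (hp : ‖p‖ < 1) (z : 𝕜) :
    Summable fun j : ℕ => ‖p ^ (j * (j - 1)) * z ^ j‖ := by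
  rcases eq_or_ne p 0 with rfl | hp0
  · refine summable_of_ne_finset_zero (s := Finset.range 2) fun j hj => ?_
    have : ¬j < 2 := by simpa only [Finset.mem_range] using hj
    rw [zero_pow (Nat.mul_ne_zero (by omega) (by omega)), zero_mul, norm_zero]
  rcases eq_or_ne z 0 with rfl | hz0
  · refine summable_of_ne_finset_zero (s := Finset.range 1) fun j hj => ?_
    have : ¬j < 1 := by simpa only [Finset.mem_range] using hj
    rw [zero_pow (by omega), mul_zero, norm_zero]
  refine summable_of_ratio_test_tendsto_lt_one (l := 0) one_pos (.of_forall fun j => by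
    simp [hp0, hz0]) ?_
  have : Tendsto (fun j : ℕ => (‖p‖ ^ 2) ^ j * ‖z‖) atTop (𝓝 (0 * ‖z‖)) :=
    (tendsto_pow_atTop_nhds_zero_of_lt_one (by positivity)
      (pow_lt_one₀ (norm_nonneg _) hp two_ne_zero)).mul_const _
  rw [zero_mul] at this
  refine this.congr fun j => ?_
  rw [pow_succ_mul_pred]
  simp only [norm_norm, norm_mul, norm_pow]
  have := norm_ne_zero_iff.2 hp0
  have := norm_ne_zero_iff.2 hz0
  field_simp
  ring

lemma summable_norm_zpow_mul_zpow {p z : 𝕜} (hp : ‖p‖ < 1) :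
    Summable fun n : ℤ => ‖p ^ (n * (n - 1)) * z ^ n‖ := by
  refine Summable.of_nat_of_neg ((summable_norm_pow_mul_pow hp z).congr fun j => ?_)
    ((summable_norm_pow_mul_pow hp (p ^ 2 * z⁻¹)).congr fun j => ?_)
  · rw [← zpow_natCast, ← zpow_natCast]
    congr 3
    rcases j with _ | j <;> simp
  · congr 1
    rw [mul_pow, ← pow_mul, ← mul_assoc, ← pow_add, zpow_neg, zpow_natCast, inv_pow,
      ← zpow_natCast]
    congr 2
    rcases j with _ | j
    · simp
    · push_cast [Nat.add_sub_cancel]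
      ring

variable [CompleteSpace 𝕜]

lemma multipliable_one_add_mul_pow_linear {x : 𝕜} (hx : ‖x‖ < 1) (c : 𝕜) {a : ℕ} (ha : 0 < a)
    (b : ℕ) : Multipliable fun k : ℕ => 1 + c * x ^ (a * k + b) :=
  multipliable_one_add_of_summable (summable_norm_mul_pow_linear hx c ha b)

lemma multipliable_one_sub_pow {x : 𝕜} (hx : ‖x‖ < 1) {a : ℕ} (ha : 0 < a) (b : ℕ) :
    Multipliable fun k : ℕ => 1 - x ^ (a * k + b) := by
  simpa [sub_eq_add_neg] using multipliable_one_add_mul_pow_linear hx (-1) ha b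

lemma tprod_one_sub_pow_ne_zero {x : 𝕜} (hx : ‖x‖ < 1) {a : ℕ} (ha : 0 < a) {b : ℕ}
    (hb : b ≠ 0) : ∏' k : ℕ, (1 - x ^ (a * k + b)) ≠ 0 := by
  have h := tprod_one_add_ne_zero_of_summable (f := fun k : ℕ => (-1) * x ^ (a * k + b))
    (fun k => by simpa [sub_eq_add_neg] using one_sub_pow_ne_zero hx (k := a * k + b) (by omega))
    (summable_norm_mul_pow_linear hx (-1) ha b)
  simpa [sub_eq_add_neg] using h

lemma tendsto_qPoch {x : 𝕜} (hx : ‖x‖ < 1) :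
    Tendsto (qPoch x) atTop (𝓝 (∏' k : ℕ, (1 - x ^ (k + 1)))) := by
  have h := (multipliable_one_sub_pow hx one_pos 1).hasProd.tendsto_prod_nat
  simp only [one_mul] at h
  exact h

lemma tprod_qPoch_ne_zero {x : 𝕜} (hx : ‖x‖ < 1) : ∏' k : ℕ, (1 - x ^ (k + 1)) ≠ 0 := by
  simpa using tprod_one_sub_pow_ne_zero hx one_pos one_ne_zero

lemma exists_norm_qPoch_le {x : 𝕜} (hx : ‖x‖ < 1) :
    ∃ C : ℝ, 0 < C ∧ ∀ k, ‖qPoch x k‖ ≤ C ∧ ‖(qPoch x k)⁻¹‖ ≤ C := by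
  obtain ⟨C₁, h₁⟩ := (tendsto_qPoch hx).norm.bddAbove_range
  obtain ⟨C₂, h₂⟩ := ((tendsto_qPoch hx).inv₀ (tprod_qPoch_ne_zero hx)).norm.bddAbove_range
  refine ⟨max 1 (max C₁ C₂), by positivity, fun k => ⟨?_, ?_⟩⟩
  · exact (h₁ ⟨k, rfl⟩).trans ((le_max_left _ _).trans (le_max_right _ _))
  · exact (h₂ ⟨k, rfl⟩).trans ((le_max_right _ _).trans (le_max_right _ _))

lemma exists_norm_gaussBinom_le {x : 𝕜} (hx : ‖x‖ < 1) :
    ∃ C : ℝ, ∀ N j, ‖gaussBinom x N j‖ ≤ C := by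
  obtain ⟨C, hC, h⟩ := exists_norm_qPoch_le hx
  refine ⟨C * (C * C), fun N j => ?_⟩
  rcases lt_or_ge N j with hj | hj
  · rw [gaussBinom_eq_zero_of_lt _ hj, norm_zero]
    positivity
  · rw [gaussBinom_eq_div hx hj, div_eq_mul_inv, mul_inv, norm_mul, norm_mul]
    gcongr
    exacts [(h _).1, (h _).2, (h _).2]

lemma tendsto_gaussBinom {x : 𝕜} (hx : ‖x‖ < 1) (j : ℕ) :
    Tendsto (fun N => gaussBinom x N j) atTop (𝓝 (qPoch x j)⁻¹) := by
  have h := (tendsto_qPoch hx).div (((tendsto_qPoch hx).comp (tendsto_sub_atTop_nat j)).const_mul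
    (qPoch x j)) (mul_ne_zero (qPoch_ne_zero hx j) (tprod_qPoch_ne_zero hx))
  have e : (∏' k : ℕ, (1 - x ^ (k + 1))) / (qPoch x j * ∏' k : ℕ, (1 - x ^ (k + 1))) =
      (qPoch x j)⁻¹ := by
    have := tprod_qPoch_ne_zero hx
    have := qPoch_ne_zero hx j
    field_simp
  rw [e] at h
  refine h.congr' ?_
  filter_upwards [eventually_ge_atTop j] with N hN
  rw [gaussBinom_eq_div hx hN]
  rfl

/-- The central coefficients; `toNat` is harmless, since `N + n ≥ 0` for large `N`. -/
lemma tendsto_gaussBinom_two_mul {x : 𝕜} (hx : ‖x‖ < 1) (n : ℤ) :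
    Tendsto (fun N : ℕ => gaussBinom x (2 * N) (N + n).toNat) atTop
      (𝓝 (∏' k : ℕ, (1 - x ^ (k + 1)))⁻¹) := by
  have hinf (m : ℤ) : Tendsto (fun N : ℕ => ((N : ℤ) + m).toNat) atTop atTop := by
    refine tendsto_atTop_atTop.2 fun b => ⟨b + m.natAbs, fun N hN => ?_⟩
    omega
  have h2 : Tendsto (fun N : ℕ => 2 * N) atTop atTop :=
    tendsto_id.const_mul_atTop' two_pos
  have hne := tprod_qPoch_ne_zero hx
  have h := ((tendsto_qPoch hx).comp h2).div
    (((tendsto_qPoch hx).comp (hinf n)).mul ((tendsto_qPoch hx).comp (hinf (-n))))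
    (mul_ne_zero hne hne)
  rw [div_mul_cancel_left₀ hne] at h
  refine h.congr' ?_
  filter_upwards [eventually_ge_atTop n.natAbs] with N hN
  rw [gaussBinom_eq_div hx (show ((N : ℤ) + n).toNat ≤ 2 * N by omega)]
  have : 2 * N - ((N : ℤ) + n).toNat = ((N : ℤ) + -n).toNat := by omega
  rw [this]
  rfl

/-- Euler's identity `∑ p^(j(j-1)) z^j / (p²; p²)_j = ∏ (1 + z p^(2k))`. -/
lemma hasSum_pow_mul_pow_div_qPoch {p : 𝕜} (hp : ‖p‖ < 1) (z : 𝕜) :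
    HasSum (fun j : ℕ => p ^ (j * (j - 1)) * z ^ j / qPoch (p ^ 2) j)
      (∏' k : ℕ, (1 + z * p ^ (2 * k))) := by
  have hp2 : ‖p ^ 2‖ < 1 := by
    rw [norm_pow]; exact pow_lt_one₀ (norm_nonneg _) hp two_ne_zero
  obtain ⟨C, hC⟩ := exists_norm_gaussBinom_le hp2
  have hs := summable_norm_pow_mul_pow hp z
  have hlim := tendsto_tsum_of_dominated_convergence (𝓕 := atTop)
    (f := fun N j => gaussBinom (p ^ 2) N j * (p ^ (j * (j - 1)) * z ^ j))
    (g := fun j => (qPoch (p ^ 2) j)⁻¹ * (p ^ (j * (j - 1)) * z ^ j))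
    (hs.mul_left C) (fun j => (tendsto_gaussBinom hp2 j).mul_const _)
    (.of_forall fun N j => by
      rw [norm_mul]
      exact mul_le_mul_of_nonneg_right (hC _ _) (norm_nonneg _))
  have hfin : ∀ N, ∑' j, gaussBinom (p ^ 2) N j * (p ^ (j * (j - 1)) * z ^ j) =
      ∏ i ∈ Finset.range N, (1 + z * p ^ (2 * i)) := by
    intro N
    rw [prod_one_add_mul_pow_eq_sum, tsum_eq_sum (s := Finset.range (N + 1))]
    · simp only [mul_assoc]
    · intro j hj
      rw [gaussBinom_eq_zero_of_lt _ (by simpa using hj), zero_mul]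
  simp only [hfin] at hlim
  have hprod := (multipliable_one_add_mul_pow_linear hp z two_pos 0).hasProd.tendsto_prod_nat
  simp only [add_zero] at hprod
  rw [tendsto_nhds_unique hprod hlim]
  have hsum : Summable fun j : ℕ => p ^ (j * (j - 1)) * z ^ j / qPoch (p ^ 2) j := by
    obtain ⟨C, -, hC⟩ := exists_norm_qPoch_le hp2
    refine Summable.of_norm_bounded (hs.mul_left C) fun j => ?_
    rw [div_eq_mul_inv, norm_mul, mul_comm]
    exact mul_le_mul_of_nonneg_right (hC _).2 (norm_nonneg _)
  convert hsum.hasSum using 1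
  exact tsum_congr fun j => by ring

/-- The Jacobi triple product identity
`∑ p^(n(n-1)) zⁿ = ∏ (1 - p^(2k+2)) (1 + z p^(2k)) (1 + z⁻¹ p^(2k+2))`, the limit of its finite
form `prod_mul_prod_eq_sum_zpow` by dominated convergence. The base is written as `p ^ 2` to keep
the exponents integral. -/
theorem hasSum_jacobi_triple_product {p z : 𝕜} (hp : ‖p‖ < 1) (hp0 : p ≠ 0) (hz : z ≠ 0) :
    HasSum (fun n : ℤ => p ^ (n * (n - 1)) * z ^ n)
      ((∏' k : ℕ, (1 - p ^ (2 * k + 2))) *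
        ((∏' k : ℕ, (1 + z * p ^ (2 * k))) * ∏' k : ℕ, (1 + z⁻¹ * p ^ (2 * k + 2)))) := by
  have hp2 : ‖p ^ 2‖ < 1 := by
    rw [norm_pow]; exact pow_lt_one₀ (norm_nonneg _) hp two_ne_zero
  obtain ⟨C, hC⟩ := exists_norm_gaussBinom_le hp2
  have hC0 : 0 ≤ C := (norm_nonneg _).trans (hC 0 0)
  have hs := summable_norm_zpow_mul_zpow (z := z) hp
  have hD : ∏' k : ℕ, (1 - p ^ (2 * k + 2)) = ∏' k : ℕ, (1 - (p ^ 2) ^ (k + 1)) :=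
    tprod_congr fun k => by rw [← pow_mul]; ring
  have hDne := tprod_qPoch_ne_zero hp2
  rw [hD]
  set D := ∏' k : ℕ, (1 - (p ^ 2) ^ (k + 1))
  have hlim := tendsto_tsum_of_dominated_convergence (𝓕 := atTop)
    -- The condition `-N ≤ n` cuts off the indices at which `toNat` would give a junk value.
    (f := fun (N : ℕ) (n : ℤ) => (if -(N : ℤ) ≤ n then gaussBinom (p ^ 2) (2 * N) (N + n).toNat
      else 0) * (p ^ (n * (n - 1)) * z ^ n))
    (g := fun n => D⁻¹ * (p ^ (n * (n - 1)) * z ^ n))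
    (hs.mul_left C) (fun n => by
      refine Tendsto.mul_const _ ((tendsto_gaussBinom_two_mul hp2 n).congr' ?_)
      filter_upwards [eventually_ge_atTop n.natAbs] with N hN
      rw [if_pos (by omega)])
    (.of_forall fun N j => by
      rw [norm_mul]
      refine mul_le_mul_of_nonneg_right ?_ (norm_nonneg _)
      split_ifs
      · exact hC _ _
      · simpa using hC0)
  have hfin : ∀ N : ℕ, ∑' n : ℤ, (if -(N : ℤ) ≤ n then gaussBinom (p ^ 2) (2 * N) (N + n).toNat
      else 0) * (p ^ (n * (n - 1)) * z ^ n) = (∏ i ∈ Finset.range N, (1 + z * p ^ (2 * i))) *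
        ∏ i ∈ Finset.range N, (1 + z⁻¹ * p ^ (2 * i + 2)) := by
    intro N
    rw [prod_mul_prod_eq_sum_zpow hp0 hz,
      tsum_eq_sum (s := (Finset.range (2 * N + 1)).image fun j : ℕ => (j : ℤ) - N),
      Finset.sum_image (by intro a _ b _ h; simpa using h)]
    · refine Finset.sum_congr rfl fun j _ => ?_
      rw [if_pos (by omega), show ((N : ℤ) + (j - N)).toNat = j by omega]
    · intro n hn
      split_ifs with h
      · rw [gaussBinom_eq_zero_of_lt, zero_mul]
        by_contra! hlt
        refine hn (Finset.mem_image.2 ⟨((N : ℤ) + n).toNat, Finset.mem_range.2 (by omega), ?_⟩)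
        omega
      · rw [zero_mul]
  simp only [hfin] at hlim
  have h1 := (multipliable_one_add_mul_pow_linear hp z two_pos 0).hasProd.tendsto_prod_nat
  have h2 := (multipliable_one_add_mul_pow_linear hp z⁻¹ two_pos 2).hasProd.tendsto_prod_nat
  simp only [add_zero] at h1
  rw [tendsto_nhds_unique (h1.mul h2) hlim, tsum_mul_left, ← mul_assoc, mul_inv_cancel₀ hDne,
    one_mul]
  exact hs.of_norm.hasSum

end Limits

/-! ### Slater's identities modulo 16 -/

section Slater

lemma tsum_int_even_add_odd {G : Type*} [NormedAddCommGroup G] [CompleteSpace G]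
    {f : ℤ → G} (hf : Summable f) :
    ∑' n, f n = ∑' m, f (2 * m) + ∑' m, f (2 * m + 1) := by
  have h2 : Function.Injective fun m : ℤ => 2 * m := mul_right_injective₀ two_ne_zero
  have h3 : Function.Injective fun m : ℤ => 2 * m + 1 := (add_left_injective 1).comp h2
  have he := h2.hasSum_range_iff.2 (hf.comp_injective h2).hasSum
  have ho := h3.hasSum_range_iff.2 (hf.comp_injective h3).hasSum
  have r2 : Set.range (fun m : ℤ => 2 * m) = {n | Even n} := by
    ext n
    simp [even_iff_exists_two_mul]
  have r3 : Set.range (fun m : ℤ => 2 * m + 1) = {n | Odd n} := by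
    ext n
    simp [Odd]
  exact (he.add_isCompl (by rw [r2, r3]; exact Int.isCompl_even_odd) ho).tsum_eq

variable {𝕜 : Type*} [NormedField 𝕜] [CompleteSpace 𝕜]

lemma summable_slater_even {x : 𝕜} (hx : ‖x‖ < 1) :
    Summable fun s : ℕ => x ^ (2 * s ^ 2) := by
  refine Summable.of_norm_bounded (summable_geometric_of_lt_one (norm_nonneg _) hx) fun s => ?_
  rw [norm_pow]
  exact pow_le_pow_of_le_one (norm_nonneg _) hx.le (by nlinarith)

lemma summable_slater_odd {x : 𝕜} (hx : ‖x‖ < 1) :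
    Summable fun s : ℕ => x ^ (2 * s * (s + 1)) := by
  refine Summable.of_norm_bounded (summable_geometric_of_lt_one (norm_nonneg _) hx) fun s => ?_
  rw [norm_pow]
  exact pow_le_pow_of_le_one (norm_nonneg _) hx.le (by nlinarith)

/-- Euler's sum at `z = p = y`, split into its even and odd terms. -/
lemma tsum_add_mul_tsum_eq_tprod {y : 𝕜} (hy : ‖y‖ < 1) :
    ∑' s : ℕ, (y ^ 2) ^ (2 * s ^ 2) / qPoch (y ^ 2) (2 * s) +
      y * ∑' s : ℕ, (y ^ 2) ^ (2 * s * (s + 1)) / qPoch (y ^ 2) (2 * s + 1) =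
      ∏' k : ℕ, (1 + y * (y ^ 2) ^ k) := by
  have h := hasSum_pow_mul_pow_div_qPoch hy y
  have h2 : Function.Injective fun m : ℕ => 2 * m := mul_right_injective₀ two_ne_zero
  have h3 : Function.Injective fun m : ℕ => 2 * m + 1 := (add_left_injective 1).comp h2
  have h4 := tsum_even_add_odd (f := fun j : ℕ => y ^ (j * (j - 1)) * y ^ j / qPoch (y ^ 2) j)
    (h.summable.comp_injective h2) (h.summable.comp_injective h3)
  rw [h.tsum_eq] at h4
  have e : ∏' k : ℕ, (1 + y * (y ^ 2) ^ k) = ∏' k : ℕ, (1 + y * y ^ (2 * k)) :=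
    tprod_congr fun k => by rw [pow_mul]
  rw [e, ← h4, ← tsum_mul_left]
  congr 1
  · refine tsum_congr fun s => ?_
    rw [← pow_mul, ← pow_add]
    congr 2
    rcases s with _ | s
    · rfl
    · rw [show 2 * (s + 1) - 1 = 2 * s + 1 by omega]; ring
  · refine tsum_congr fun s => ?_
    simp only [Nat.add_sub_cancel]
    rw [← pow_mul, ← pow_add, ← mul_div_assoc, ← pow_succ']
    congr 2
    ring

/-- The triple product at `p = y ^ 2`, `z = y`, with its series split into even and odd terms. -/
lemma tprod_mul_tprod_eq_tsum_add {y : 𝕜} (hy : ‖y‖ < 1) (hy0 : y ≠ 0) :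
    (∏' k : ℕ, (1 - (y ^ 2) ^ (2 * k + 2))) * ∏' k : ℕ, (1 + y * (y ^ 2) ^ k) =
      ∑' m : ℤ, ((y ^ 2) ^ 4) ^ (m * (m - 1)) * ((y ^ 2) ^ 3) ^ m +
        y * ∑' m : ℤ, ((y ^ 2) ^ 4) ^ (m * (m - 1)) * ((y ^ 2) ^ 7) ^ m := by
  have hx : ‖y ^ 2‖ < 1 := by
    rw [norm_pow]; exact pow_lt_one₀ (norm_nonneg _) hy two_ne_zero
  have hx0 : y ^ 2 ≠ 0 := pow_ne_zero 2 hy0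
  have h := hasSum_jacobi_triple_product hx hx0 hy0
  have e : ∏' k : ℕ, (1 + y * (y ^ 2) ^ k) =
      (∏' k : ℕ, (1 + y * (y ^ 2) ^ (2 * k))) * ∏' k : ℕ, (1 + y⁻¹ * (y ^ 2) ^ (2 * k + 2)) := by
    have he := multipliable_one_add_mul_pow_linear hx y two_pos 0
    have ho := multipliable_one_add_mul_pow_linear hx y two_pos 1
    rw [← tprod_even_mul_odd (f := fun k : ℕ => 1 + y * (y ^ 2) ^ k) he ho]
    congr 1
    refine tprod_congr fun k => ?_
    congr 1
    field_simp
    ring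
  rw [e, ← h.tsum_eq, tsum_int_even_add_odd h.summable, ← tsum_mul_left]
  congr 1
  · refine tsum_congr fun m => ?_
    simp only [← zpow_natCast, ← zpow_mul, ← zpow_add₀ hy0]
    congr 1
    push_cast
    ring
  · refine tsum_congr fun m => ?_
    simp only [← zpow_natCast, ← zpow_mul]
    nth_rewrite 3 [← zpow_one y]
    simp only [← zpow_add₀ hy0]
    congr 1
    push_cast
    ring

/-- The Jacobi triple product with base `x ^ 8`. -/
lemma tsum_zpow_eight {x : 𝕜} (hx : ‖x‖ < 1) (hx0 : x ≠ 0) {a b : ℕ} (hab : a + b = 8) :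
    ∑' m : ℤ, (x ^ 4) ^ (m * (m - 1)) * (x ^ a) ^ m =
      (∏' k : ℕ, (1 - x ^ (8 * k + 8))) *
        ((∏' k : ℕ, (1 + x ^ (8 * k + a))) * ∏' k : ℕ, (1 + x ^ (8 * k + b))) := by
  have h4 : ‖x ^ 4‖ < 1 := by
    rw [norm_pow]; exact pow_lt_one₀ (norm_nonneg _) hx four_ne_zero
  rw [(hasSum_jacobi_triple_product h4 (pow_ne_zero 4 hx0) (pow_ne_zero a hx0)).tsum_eq]
  congr 1
  · exact tprod_congr fun k => by rw [← pow_mul]; ring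
  congr 1
  · exact tprod_congr fun k => by rw [← pow_mul, ← pow_add]; ring
  · refine tprod_congr fun k => ?_
    congr 1
    rw [← pow_mul, inv_mul_eq_iff_eq_mul₀ (pow_ne_zero a hx0), ← pow_add]
    congr 1
    omega

end Slater

/-- Slater's identities for `x = y ^ 2`, from comparison of the parts even and odd in `y` of
`D E(y) = D P(y) = J(y)`, where `D = ∏ (1 - x^(2k))`, `E` is Euler's sum, `P` its product and `J`
the theta series. -/
lemma slater_identities_complex {y : ℂ} (hy : ‖y‖ < 1) (hy0 : y ≠ 0) :
    (∏' k : ℕ, (1 - (y ^ 2) ^ (2 * k + 2))) *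
        ∑' s : ℕ, (y ^ 2) ^ (2 * s ^ 2) / qPoch (y ^ 2) (2 * s) =
      (∏' k : ℕ, (1 - (y ^ 2) ^ (8 * k + 8))) *
        ((∏' k : ℕ, (1 + (y ^ 2) ^ (8 * k + 3))) * ∏' k : ℕ, (1 + (y ^ 2) ^ (8 * k + 5))) ∧
    (∏' k : ℕ, (1 - (y ^ 2) ^ (2 * k + 2))) *
        ∑' s : ℕ, (y ^ 2) ^ (2 * s * (s + 1)) / qPoch (y ^ 2) (2 * s + 1) =
      (∏' k : ℕ, (1 - (y ^ 2) ^ (8 * k + 8))) *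
        ((∏' k : ℕ, (1 + (y ^ 2) ^ (8 * k + 7))) * ∏' k : ℕ, (1 + (y ^ 2) ^ (8 * k + 1))) := by
  have hx : ‖y ^ 2‖ < 1 := by
    rw [norm_pow]; exact pow_lt_one₀ (norm_nonneg _) hy two_ne_zero
  have hx0 : y ^ 2 ≠ 0 := pow_ne_zero 2 hy0
  -- Replacing `y` by `-y` fixes `x = y ^ 2` and changes the sign of the odd part.
  have e1 := tsum_add_mul_tsum_eq_tprod hy
  have e2 := tsum_add_mul_tsum_eq_tprod (y := -y) (by rwa [norm_neg])
  have j1 := tprod_mul_tprod_eq_tsum_add hy hy0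
  have j2 := tprod_mul_tprod_eq_tsum_add (y := -y) (by rwa [norm_neg]) (neg_ne_zero.2 hy0)
  rw [← e1] at j1
  rw [← e2] at j2
  simp only [neg_sq] at j2
  rw [← tsum_zpow_eight hx hx0 (by norm_num : 3 + 5 = 8),
    ← tsum_zpow_eight hx hx0 (by norm_num : 7 + 1 = 8)]
  constructor
  · linear_combination (j1 + j2) / 2
  · apply mul_left_cancel₀ hy0
    linear_combination (j1 - j2) / 2

/-- Slater's identities for real `x`; a complex square root of `x` is used in the proof only. -/
lemma slater_identities {x : ℝ} (hx : |x| < 1) (hx0 : x ≠ 0) :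
    (∏' k : ℕ, (1 - x ^ (2 * k + 2))) * ∑' s : ℕ, x ^ (2 * s ^ 2) / qPoch x (2 * s) =
      (∏' k : ℕ, (1 - x ^ (8 * k + 8))) *
        ((∏' k : ℕ, (1 + x ^ (8 * k + 3))) * ∏' k : ℕ, (1 + x ^ (8 * k + 5))) ∧
    (∏' k : ℕ, (1 - x ^ (2 * k + 2))) *
        ∑' s : ℕ, x ^ (2 * s * (s + 1)) / qPoch x (2 * s + 1) =
      (∏' k : ℕ, (1 - x ^ (8 * k + 8))) *
        ((∏' k : ℕ, (1 + x ^ (8 * k + 7))) * ∏' k : ℕ, (1 + x ^ (8 * k + 1))) := by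
  obtain ⟨y, hy⟩ := IsAlgClosed.exists_pow_nat_eq (x : ℂ) two_pos
  have hy0 : y ≠ 0 := by
    rintro rfl
    rw [zero_pow two_ne_zero] at hy
    exact hx0 (Complex.ofReal_eq_zero.1 hy.symm)
  have hy1 : ‖y‖ < 1 := by
    have h : ‖y‖ ^ 2 < 1 := by rw [← norm_pow, hy, Complex.norm_real]; exact hx
    exact (pow_lt_one_iff_of_nonneg (norm_nonneg _) two_ne_zero).1 h
  have hx' : ‖x‖ < 1 := hx
  have hprod (f : ℕ → ℝ) (hf : Multipliable f) :
      ((∏' k, f k : ℝ) : ℂ) = ∏' k, (f k : ℂ) :=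
    ((hf.hasProd.map Complex.ofRealHom Complex.continuous_ofReal).tprod_eq).symm
  have hq (k : ℕ) : ((qPoch x k : ℝ) : ℂ) = qPoch (x : ℂ) k := by
    simp [qPoch]
  have hp (a : ℕ) : Multipliable fun k : ℕ => 1 + x ^ (8 * k + a) := by
    simpa using multipliable_one_add_mul_pow_linear hx' 1 (show 0 < 8 by norm_num) a
  have h := slater_identities_complex hy1 hy0
  rw [hy] at h
  constructor
  · apply Complex.ofReal_injective
    have := h.1
    push_cast [hprod _ (hp _), hprod _ (multipliable_one_sub_pow hx' two_pos 2),
      hprod _ (multipliable_one_sub_pow hx' (show 0 < 8 by norm_num) 8), hq]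
    exact this
  · apply Complex.ofReal_injective
    have := h.2
    push_cast [hprod _ (hp _), hprod _ (multipliable_one_sub_pow hx' two_pos 2),
      hprod _ (multipliable_one_sub_pow hx' (show 0 < 8 by norm_num) 8), hq]
    exact this

/-! ### The limits of the sums -/

/-- The number of self-adjoint square-zero endomorphisms of rank `r` of a nondegenerate Hermitian
space of dimension `n` over the field with `q ^ 2` elements, defined by its recursion. For
`n < 2` the truncated subtractions do no harm: one of the two factors in the numerator is zero. -/
noncomputable def sqZeroCount (q : ℝ) : ℕ → ℕ → ℝ
  | _, 0 => 1
  | n, r + 1 => q ^ r * (q ^ n - (-1) ^ n) * (q ^ (n - 1) - (-1) ^ (n - 1)) /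
      (q ^ (r + 1) - (-1) ^ (r + 1)) * sqZeroCount q (n - 2) r

lemma sqZeroCount_zero (q : ℝ) (n : ℕ) : sqZeroCount q n 0 = 1 := by
  cases n <;> rfl

lemma sqZeroCount_succ (q : ℝ) (n r : ℕ) : sqZeroCount q n (r + 1) =
    q ^ r * (q ^ n - (-1) ^ n) * (q ^ (n - 1) - (-1) ^ (n - 1)) /
      (q ^ (r + 1) - (-1) ^ (r + 1)) * sqZeroCount q (n - 2) r := by
  cases n <;> rfl

lemma pow_sub_neg_one_pow_eq {q : ℝ} (hq : q ≠ 0) (i : ℕ) :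
    q ^ i - (-1) ^ i = q ^ i * (1 - (-q⁻¹) ^ i) := by
  have h : (-q⁻¹) ^ i = (-1) ^ i * (q ^ i)⁻¹ := by rw [neg_pow, inv_pow]
  rw [h]
  field_simp

lemma sqZeroCount_eq_zero (q : ℝ) {n r : ℕ} (h : n < 2 * r) : sqZeroCount q n r = 0 := by
  induction r generalizing n with
  | zero => omega
  | succ r ih =>
    rw [sqZeroCount_succ]
    rcases lt_or_ge n 2 with hn | hn
    · interval_cases n <;> simp
    · rw [ih (by omega), mul_zero]

lemma abs_neg_inv_lt_one {q : ℝ} (hq : 1 < q) : |(-q⁻¹)| < 1 := by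
  rw [abs_neg, abs_of_pos (by positivity)]
  exact inv_lt_one_of_one_lt₀ hq

/-- The closed form of the count, for a space of dimension `n = m + 2 r`; the powers of `q` are
split off, so that only `q`-Pochhammer symbols at `-1/q` remain. -/
lemma sqZeroCount_add {q : ℝ} (hq : 1 < q) (m r : ℕ) : sqZeroCount q (m + 2 * r) r =
    q ^ (2 * r * (m + r)) * (qPoch (-q⁻¹) (m + 2 * r) /
      (qPoch (-q⁻¹) m * qPoch (-q⁻¹) r)) := by
  have hq0 : q ≠ 0 := by positivity
  have hx : ‖(-q⁻¹)‖ < 1 := abs_neg_inv_lt_one hq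
  have hE := qPoch_ne_zero hx
  induction r with
  | zero => simp [sqZeroCount_zero, hE m]
  | succ r ih =>
    rw [sqZeroCount_succ, show m + 2 * (r + 1) - 2 = m + 2 * r by omega, ih,
      show m + 2 * (r + 1) - 1 = m + 2 * r + 1 by omega,
      show m + 2 * (r + 1) = m + 2 * r + 1 + 1 by omega, qPoch_succ _ (m + 2 * r + 1),
      qPoch_succ _ (m + 2 * r), qPoch_succ _ r]
    simp only [pow_sub_neg_one_pow_eq hq0]
    have h1 := hE m
    have h2 := hE r
    have h3 := one_sub_pow_ne_zero hx (Nat.succ_ne_zero r)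
    generalize (1 - (-q⁻¹) ^ (r + 1)) = A at *
    generalize (1 - (-q⁻¹) ^ (m + 2 * r + 1)) = B at *
    generalize (1 - (-q⁻¹) ^ (m + 2 * r + 1 + 1)) = C at *
    have e : q ^ (2 * (r + 1) * (m + (r + 1))) * q ^ (r + 1) =
        q ^ r * q ^ (m + 2 * r + 1 + 1) * q ^ (m + 2 * r + 1) * q ^ (2 * r * (m + r)) := by
      simp only [← pow_add]
      congr 1
      ring
    field_simp
    linear_combination -C * e

/-- The number of all self-adjoint square-zero endomorphisms of a nondegenerate Hermitian space of
dimension `n` over the field with `q ^ 2` elements. -/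
noncomputable def sqZeroTotal (q : ℝ) (n : ℕ) : ℝ :=
  ∑ r ∈ Finset.range (n + 1), sqZeroCount q n r

/-- With `e` the parity of the dimension `2 l + e`, the sum over ranks `r = l - s`, where
`2 s + e` is the dimension of the kernel modulo the image. -/
lemma sqZeroTotal_eq {q : ℝ} (hq : 1 < q) (l e : ℕ) (he : e < 2) :
    sqZeroTotal q (2 * l + e) = q ^ (2 * l * (l + e)) * ∑ s ∈ Finset.range (l + 1),
      (-q⁻¹) ^ (2 * s * (s + e)) * (qPoch (-q⁻¹) (2 * l + e) /
        (qPoch (-q⁻¹) (2 * s + e) * qPoch (-q⁻¹) (l - s))) := by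
  have hq0 : q ≠ 0 := by positivity
  have h1 : sqZeroTotal q (2 * l + e) =
      ∑ r ∈ Finset.range (l + 1), sqZeroCount q (2 * l + e) r := by
    refine (Finset.sum_subset (fun r hr => ?_) fun r _ hr => ?_).symm
    · rw [Finset.mem_range] at hr ⊢
      omega
    · rw [Finset.mem_range] at hr
      exact sqZeroCount_eq_zero _ (by omega)
  rw [h1, ← Finset.sum_range_reflect, Finset.mul_sum]
  refine Finset.sum_congr rfl fun s hs => ?_
  have hs : s ≤ l := Nat.lt_succ_iff.1 (Finset.mem_range.1 hs)
  obtain ⟨r, rfl⟩ := Nat.exists_eq_add_of_le hs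
  rw [show s + r + 1 - 1 - s = r by omega, show s + r - s = r by omega,
    show 2 * (s + r) + e = 2 * s + e + 2 * r by omega, sqZeroCount_add hq, ← mul_assoc]
  congr 1
  have h2 : (-q⁻¹) ^ (2 * s * (s + e)) = (q ^ (2 * s * (s + e)))⁻¹ := by
    rw [mul_assoc 2 s, pow_mul, neg_sq, inv_pow, inv_pow, ← pow_mul]
  rw [h2, eq_mul_inv_iff_mul_eq₀ (by positivity), ← pow_add]
  congr 1
  ring

lemma tendsto_sum_qPoch {x : ℝ} (hx : |x| < 1) (e : ℕ) {c : ℕ → ℝ} (hc : Summable c) :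
    Tendsto (fun l => ∑ s ∈ Finset.range (l + 1),
        c s * (qPoch x (2 * l + e) / (qPoch x (2 * s + e) * qPoch x (l - s)))) atTop
      (𝓝 (∑' s, c s / qPoch x (2 * s + e))) := by
  have hx : ‖x‖ < 1 := hx
  obtain ⟨C, hC, hb⟩ := exists_norm_qPoch_le hx
  have hlim := tendsto_tsum_of_dominated_convergence (𝓕 := atTop)
    (f := fun l s => if s ∈ Finset.range (l + 1) then
      c s * (qPoch x (2 * l + e) / (qPoch x (2 * s + e) * qPoch x (l - s))) else 0)
    (g := fun s => c s / qPoch x (2 * s + e)) (bound := fun s => ‖c s‖ * (C * (C * C)))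
    (hc.norm.mul_right _) (fun s => ?_) (.of_forall fun l s => ?_)
  · refine hlim.congr fun l => ?_
    rw [tsum_eq_sum (s := Finset.range (l + 1)) fun s hs => if_neg hs]
    exact Finset.sum_congr rfl fun s hs => if_pos hs
  · have h2 : Tendsto (fun l : ℕ => 2 * l + e) atTop atTop :=
      tendsto_atTop_mono (fun l => show l ≤ 2 * l + e by omega) tendsto_id
    have hD := tprod_qPoch_ne_zero hx
    have hs := qPoch_ne_zero hx (2 * s + e)
    have h := (((tendsto_qPoch hx).comp h2).div
      (((tendsto_qPoch hx).comp (tendsto_sub_atTop_nat s)).const_mul (qPoch x (2 * s + e)))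
      (mul_ne_zero hs hD)).const_mul (c s)
    rw [mul_comm (qPoch x _), div_mul_cancel_left₀ hD, ← div_eq_mul_inv] at h
    refine h.congr' ?_
    filter_upwards [eventually_ge_atTop s] with l hl
    rw [if_pos (Finset.mem_range.2 (by omega))]
    rfl
  · split_ifs
    · rw [norm_mul, div_eq_mul_inv, mul_inv, norm_mul, norm_mul]
      gcongr
      exacts [(hb _).1, (hb _).2, (hb _).2]
    · rw [norm_zero]
      positivity

lemma tendsto_sqZeroTotal {q : ℝ} (hq : 1 < q) {e : ℕ} (he : e < 2) :
    Tendsto (fun l => sqZeroTotal q (2 * l + e) / q ^ (2 * l * (l + e))) atTop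
      (𝓝 (∑' s : ℕ, (-q⁻¹) ^ (2 * s * (s + e)) / qPoch (-q⁻¹) (2 * s + e))) := by
  have hx := abs_neg_inv_lt_one hq
  have hs : Summable fun s : ℕ => (-q⁻¹) ^ (2 * s * (s + e)) := by
    interval_cases e
    · simpa only [add_zero, mul_assoc, ← sq] using summable_slater_even (x := -q⁻¹) hx
    · exact summable_slater_odd (x := -q⁻¹) hx
  refine (tendsto_sum_qPoch hx e hs).congr fun l => ?_
  have : q ≠ 0 := by positivity
  rw [sqZeroTotal_eq hq l e he, mul_div_cancel_left₀ _ (pow_ne_zero _ this)]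

lemma limitFactor_eq (q : ℕ) {a b : ℕ} (ha : Odd a) (hb : Odd b) (k : ℕ) :
    limitFactor q (8 - a) (8 - b) (k + 1) =
      (1 + (-(q : ℝ)⁻¹) ^ (8 * k + a)) * (1 + (-(q : ℝ)⁻¹) ^ (8 * k + b)) *
        (1 - (-(q : ℝ)⁻¹) ^ (8 * k + 8)) / (1 - (-(q : ℝ)⁻¹) ^ (2 * k + 2)) := by
  have key (n : ℕ) (i : ℤ) (hi : i = -n) : (q : ℝ) ^ i = (q : ℝ)⁻¹ ^ n := by
    rw [hi, zpow_neg, zpow_natCast, inv_pow]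
  have h8 (c : ℕ) (hc : Odd c) : Odd (8 * k + c) := Even.add_odd ⟨4 * k, by ring⟩ hc
  rw [limitFactor, key (8 * k + a) _ (by push_cast; ring), key (8 * k + b) _ (by push_cast; ring),
    key (8 * k + 8) _ (by push_cast; ring), key (2 * k + 2) _ (by push_cast; ring),
    (h8 a ha).neg_pow, (h8 b hb).neg_pow, Even.neg_pow ⟨4 * k + 4, by ring⟩,
    Even.neg_pow ⟨k + 1, by ring⟩]
  simp only [sub_eq_add_neg]

lemma hasProd_limitFactor {q : ℕ} (hq : 1 < q) {a b : ℕ} (ha : Odd a) (hb : Odd b) :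
    HasProd (fun k : ℕ => limitFactor q (8 - a) (8 - b) (k + 1))
      ((∏' k : ℕ, (1 + (-(q : ℝ)⁻¹) ^ (8 * k + a))) *
        (∏' k : ℕ, (1 + (-(q : ℝ)⁻¹) ^ (8 * k + b))) *
        (∏' k : ℕ, (1 - (-(q : ℝ)⁻¹) ^ (8 * k + 8))) /
        ∏' k : ℕ, (1 - (-(q : ℝ)⁻¹) ^ (2 * k + 2))) := by
  have hx : ‖(-(q : ℝ)⁻¹)‖ < 1 := abs_neg_inv_lt_one (by exact_mod_cast hq)
  have h8 : 0 < 8 := by norm_num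
  have hp (a : ℕ) : Multipliable fun k : ℕ => 1 + (-(q : ℝ)⁻¹) ^ (8 * k + a) := by
    simpa only [one_mul] using multipliable_one_add_mul_pow_linear hx 1 h8 a
  simp only [limitFactor_eq q ha hb]
  exact (((hp a).hasProd.mul (hp b).hasProd).mul
    (multipliable_one_sub_pow hx h8 8).hasProd).div₀
    (multipliable_one_sub_pow hx two_pos 2).hasProd (tprod_one_sub_pow_ne_zero hx two_pos two_ne_zero)

lemma tendsto_sqZeroTotal_even {q : ℕ} (hq : 1 < q) :
    Tendsto (fun n : ℕ => sqZeroTotal q n / (q : ℝ) ^ (n ^ 2 / 2)) (atTop ⊓ 𝓟 {n | Even n})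
      (𝓝 (∏' k : ℕ, limitFactor q 3 5 (k + 1))) := by
  have hq' : 1 < (q : ℝ) := by exact_mod_cast hq
  have hx := abs_neg_inv_lt_one hq'
  have h := tendsto_sqZeroTotal hq' (e := 0) two_pos
  have hval : ∑' s : ℕ, (-(q : ℝ)⁻¹) ^ (2 * s * (s + 0)) / qPoch (-(q : ℝ)⁻¹) (2 * s + 0) =
      ∏' k : ℕ, limitFactor q 3 5 (k + 1) := by
    have hp := (hasProd_limitFactor hq (a := 5) (b := 3) (by decide) (by decide)).tprod_eq
    norm_num at hp
    norm_num
    rw [hp]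
    have hs := (slater_identities hx (by simp; omega)).1
    have hne := tprod_one_sub_pow_ne_zero (x := -(q : ℝ)⁻¹) hx two_pos two_ne_zero
    rw [eq_div_iff hne, mul_comm]
    simp only [mul_assoc, ← sq]
    rw [hs]
    ring
  rw [hval] at h
  intro t ht
  obtain ⟨L, hL⟩ := eventually_atTop.1 (h ht)
  refine mem_map.2 (mem_inf_principal.2 ?_)
  filter_upwards [eventually_ge_atTop (2 * L)] with n hn hev
  obtain ⟨l, rfl⟩ := even_iff_exists_two_mul.1 hev
  have e : (2 * l) ^ 2 / 2 = 2 * l * (l + 0) := Nat.div_eq_of_eq_mul_right two_pos (by ring)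
  rw [Set.mem_preimage, e]
  exact hL l (by omega)

lemma tendsto_sqZeroTotal_odd {q : ℕ} (hq : 1 < q) :
    Tendsto (fun n : ℕ => sqZeroTotal q n / (q : ℝ) ^ ((n ^ 2 - 1) / 2)) (atTop ⊓ 𝓟 {n | Odd n})
      (𝓝 (∏' k : ℕ, limitFactor q 1 7 (k + 1))) := by
  have hq' : 1 < (q : ℝ) := by exact_mod_cast hq
  have hx := abs_neg_inv_lt_one hq'
  have h := tendsto_sqZeroTotal hq' (e := 1) one_lt_two
  have hval : ∑' s : ℕ, (-(q : ℝ)⁻¹) ^ (2 * s * (s + 1)) / qPoch (-(q : ℝ)⁻¹) (2 * s + 1) =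
      ∏' k : ℕ, limitFactor q 1 7 (k + 1) := by
    have hp := (hasProd_limitFactor hq (a := 7) (b := 1) (by decide) (by decide)).tprod_eq
    norm_num at hp
    rw [hp]
    have hs := (slater_identities hx (by simp; omega)).2
    have hne := tprod_one_sub_pow_ne_zero (x := -(q : ℝ)⁻¹) hx two_pos two_ne_zero
    rw [eq_div_iff hne, mul_comm, hs]
    ring
  rw [hval] at h
  intro t ht
  obtain ⟨L, hL⟩ := eventually_atTop.1 (h ht)
  refine mem_map.2 (mem_inf_principal.2 ?_)
  filter_upwards [eventually_ge_atTop (2 * L + 1)] with n hn hodd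
  obtain ⟨l, rfl⟩ := hodd
  have e : ((2 * l + 1) ^ 2 - 1) / 2 = 2 * l * (l + 1) :=
    Nat.div_eq_of_eq_mul_right two_pos (Nat.sub_eq_of_eq_add (by ring))
  rw [Set.mem_preimage, e]
  exact hL l (by omega)

/-! ### Norms and fixed elements of the field with `q ^ 2` elements -/

/-- `K` has `q ^ 2` elements and `a ↦ a ^ q` is additive, hence an automorphism of order two. -/
structure IsQuadraticField (K : Type*) [Field K] (q : ℕ) : Prop where
  card : Nat.card K = q ^ 2
  add_pow : ∀ a b : K, (a + b) ^ q = a ^ q + b ^ q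

lemma card_eq_mul_of_fiber {α β : Type*} [Finite α] [Finite β] (f : α → β) (c : ℕ)
    (h : ∀ b, Nat.card {a // f a = b} = c) : Nat.card α = Nat.card β * c := by
  have := Fintype.ofFinite β
  rw [Nat.card_congr (Equiv.sigmaFiberEquiv f).symm, Nat.card_sigma, Finset.sum_congr rfl
    (fun b _ => h b), Finset.sum_const, smul_eq_mul, Finset.card_univ, Nat.card_eq_fintype_card]

namespace IsQuadraticField

lemma card_units {K : Type*} [Field K] {q : ℕ} (hK : IsQuadraticField K q) :
    Nat.card Kˣ = (q - 1) * (q + 1) := by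
  rw [Nat.card_units, hK.card, ← one_pow 2, Nat.sq_sub_sq, mul_comm, one_pow]

variable {K : Type*} [Field K] [Finite K] {q : ℕ} (hK : IsQuadraticField K q)

include hK

lemma one_lt : 1 < q := by
  have h : 1 < q ^ 2 := hK.card ▸ Finite.one_lt_card
  by_contra! hq
  interval_cases q <;> simp at h

lemma pow_pow (a : K) : (a ^ q) ^ q = a := by
  have := Fintype.ofFinite K
  rw [← pow_mul, ← sq, ← hK.card, Nat.card_eq_fintype_card, FiniteField.pow_card]

lemma zero_pow : (0 : K) ^ q = 0 := _root_.zero_pow (by have := hK.one_lt; omega)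

lemma neg_pow (a : K) : (-a) ^ q = -a ^ q := by
  have h := hK.add_pow (-a) a
  rw [neg_add_cancel, hK.zero_pow] at h
  exact eq_neg_of_add_eq_zero_left h.symm

lemma card_fixed : Nat.card {a : K // a ≠ 0 ∧ a ^ q = a} = q - 1 := by
  have hq := hK.one_lt
  have h := IsCyclic.card_powMonoidHom_ker (G := Kˣ) (q - 1)
  rw [hK.card_units, Nat.gcd_eq_right (dvd_mul_right _ _)] at h
  rw [← h]
  refine Nat.card_congr
    { toFun := fun a => ⟨Units.mk0 a.1 a.2.1, ?_⟩
      invFun := fun a => ⟨a.1, a.1.ne_zero, ?_⟩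
      left_inv := fun a => rfl
      right_inv := fun a => by ext; rfl }
  · rw [MonoidHom.mem_ker, powMonoidHom_apply]
    ext
    apply mul_left_cancel₀ a.2.1
    simp only [Units.val_pow_eq_pow_val, Units.val_mk0, Units.val_one, mul_one]
    rw [← pow_succ', Nat.sub_add_cancel hq.le, a.2.2]
  · have h1 : (a.1 : Kˣ) ^ (q - 1) = 1 := a.2
    calc ((a.1 : Kˣ) : K) ^ q = ((a.1 ^ (q - 1) * a.1 : Kˣ) : K) := by
          rw [← pow_succ, Nat.sub_add_cancel hq.le, Units.val_pow_eq_pow_val]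
      _ = _ := by rw [h1, one_mul]

/-- The norm `a ↦ a ^ (q + 1)` maps `Kˣ` onto the nonzero fixed elements, with fibres of size
`q + 1`. -/
lemma card_norm_eq {t : K} (ht0 : t ≠ 0) (ht : t ^ q = t) :
    Nat.card {a : K // a ^ (q + 1) = t} = q + 1 := by
  have hq := hK.one_lt
  have hker := IsCyclic.card_powMonoidHom_ker (G := Kˣ) (q + 1)
  have hrange := IsCyclic.card_powMonoidHom_range (G := Kˣ) (q + 1)
  have hker' := IsCyclic.card_powMonoidHom_ker (G := Kˣ) (q - 1)
  rw [hK.card_units, Nat.gcd_eq_right (dvd_mul_left _ _)] at hker hrange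
  rw [hK.card_units, Nat.gcd_eq_right (dvd_mul_right _ _)] at hker'
  rw [Nat.mul_div_cancel _ (Nat.succ_pos q)] at hrange
  have hle : (powMonoidHom (q + 1) : Kˣ →* Kˣ).range ≤ (powMonoidHom (q - 1) : Kˣ →* Kˣ).ker := by
    rintro _ ⟨a, rfl⟩
    rw [MonoidHom.mem_ker, powMonoidHom_apply, powMonoidHom_apply, ← pow_mul, mul_comm,
      ← hK.card_units, pow_card_eq_one']
  have heq := Subgroup.eq_of_le_of_card_ge hle (by rw [hrange, hker'])
  have hmem : Units.mk0 t ht0 ∈ (powMonoidHom (q + 1) : Kˣ →* Kˣ).range := by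
    rw [heq, MonoidHom.mem_ker, powMonoidHom_apply]
    ext
    apply mul_left_cancel₀ ht0
    simp only [Units.val_pow_eq_pow_val, Units.val_mk0, Units.val_one, mul_one]
    rw [← pow_succ', Nat.sub_add_cancel hq.le, ht]
  obtain ⟨b, hb⟩ := hmem
  have hb' : (b : K) ^ (q + 1) = t := by
    have := congrArg Units.val hb
    simpa using this
  have hne (a : {a : K // a ^ (q + 1) = t}) : a.1 ≠ 0 := fun h =>
    ht0 (by rw [← a.2, h, _root_.zero_pow (Nat.succ_ne_zero q)])
  have hto (a : {a : K // a ^ (q + 1) = t}) :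
      Units.mk0 a.1 (hne a) * b⁻¹ ∈ (powMonoidHom (q + 1) : Kˣ →* Kˣ).ker := by
    rw [MonoidHom.mem_ker, powMonoidHom_apply]
    ext
    simp only [mul_pow, inv_pow, Units.val_mul, Units.val_pow_eq_pow_val, Units.val_mk0,
      Units.val_inv_eq_inv_val, Units.val_one]
    rw [a.2, hb', mul_inv_cancel₀ ht0]
  have hinv (a : (powMonoidHom (q + 1) : Kˣ →* Kˣ).ker) : ((a.1 * b : Kˣ) : K) ^ (q + 1) = t := by
    have h1 : (a.1 : Kˣ) ^ (q + 1) = 1 := a.2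
    rw [← Units.val_pow_eq_pow_val, mul_pow, h1, one_mul, Units.val_pow_eq_pow_val, hb']
  exact (Nat.card_congr
    { toFun := fun a => ⟨_, hto a⟩
      invFun := fun a => ⟨_, hinv a⟩
      left_inv := fun a => by ext; simp
      right_inv := fun a => by ext; simp }).trans hker

/-- The trace of `K` over its fixed field does not vanish. -/
lemma exists_add_pow_ne_zero : ∃ d : K, d + d ^ q ≠ 0 := by
  by_contra! h
  have h2 : (1 : K) = -1 := by
    have := h 1
    rw [one_pow] at this
    exact eq_neg_of_add_eq_zero_left this
  have hfix : ∀ d : K, d ^ q = d := by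
    intro d
    have := eq_neg_of_add_eq_zero_right (h d)
    rw [this, ← neg_one_mul, ← h2, one_mul]
  have h3 : Nat.card Kˣ = q - 1 := by
    rw [← hK.card_fixed]
    refine Nat.card_congr (unitsEquivNeZero.trans (Equiv.subtypeEquivRight fun a => ?_))
    simp [hfix]
  have hq := hK.one_lt
  rw [hK.card_units] at h3
  have : (q - 1) * (q + 1) = (q - 1) * 1 := by rw [h3, mul_one]
  have := Nat.eq_of_mul_eq_mul_left (by omega) this
  omega

end IsQuadraticField

/-! ### Hermitian forms and their isotropic vectors -/

/-- `B` is a Hermitian form, possibly degenerate, with respect to the automorphism `a ↦ a ^ q`: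
linear in the second variable and semilinear in the first. -/
structure IsHermitianForm {K V : Type*} [Field K] [AddCommGroup V] [Module K V] (q : ℕ)
    (B : V → V → K) : Prop where
  add_right : ∀ x y z, B x (y + z) = B x y + B x z
  smul_right : ∀ (x : V) (a : K) (y : V), B x (a • y) = a * B x y
  conj : ∀ x y, B x y ^ q = B y x

namespace IsHermitianForm

variable {K V : Type*} [Field K] [AddCommGroup V] [Module K V] {q : ℕ} {B : V → V → K}

section Basic

variable (hB : IsHermitianForm q B)

include hB

lemma zero_right (x : V) : B x 0 = 0 := by
  simpa using hB.smul_right x 0 0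

lemma neg_right (x y : V) : B x (-y) = -B x y := by
  simpa using hB.smul_right x (-1) y

lemma sub_right (x y z : V) : B x (y - z) = B x y - B x z := by
  rw [sub_eq_add_neg, hB.add_right, hB.neg_right, sub_eq_add_neg]

lemma smul_left (x : V) (a : K) (y : V) : B (a • x) y = a ^ q * B x y := by
  rw [← hB.conj, hB.smul_right, mul_pow, hB.conj]

lemma restrict (U : Submodule K V) : IsHermitianForm q fun x y : U => B x y where
  add_right x y z := hB.add_right x y z
  smul_right x a y := hB.smul_right x a y
  conj x y := hB.conj x y

/-- The linear functional `B x`. -/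
def toDual (x : V) : V →ₗ[K] K where
  toFun := B x
  map_add' := hB.add_right x
  map_smul' := hB.smul_right x

/-- The radical of a Hermitian form. -/
def radical : Submodule K V where
  carrier := {x | ∀ y, B y x = 0}
  add_mem' ha hb y := by rw [hB.add_right, ha, hb, add_zero]
  zero_mem' y := hB.zero_right y
  smul_mem' c x hx y := by rw [hB.smul_right, hx, mul_zero]

/-- The orthogonal complement of a vector. -/
def perp (v : V) : Submodule K V := LinearMap.ker (hB.toDual v)

lemma mem_perp {v x : V} : x ∈ hB.perp v ↔ B v x = 0 := Iff.rfl

end Basic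

/-- The orthogonal decomposition of the space along an anisotropic vector. -/
noncomputable def splitEquiv (hB : IsHermitianForm q B) {v : V} (hv : B v v ≠ 0) :
    (K × hB.perp v) ≃ₗ[K] V where
  toFun p := p.1 • v + p.2
  map_add' p p' := by
    simp only [Prod.fst_add, Prod.snd_add, Submodule.coe_add, add_smul]
    abel
  map_smul' c p := by simp [mul_smul]
  invFun x := (B v x / B v v, ⟨x - (B v x / B v v) • v, by
    rw [hB.mem_perp, hB.sub_right, hB.smul_right, div_mul_cancel₀ _ hv, sub_self]⟩)
  left_inv p := by
    have h1 : B v (p.1 • v + p.2) / B v v = p.1 := by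
      rw [hB.add_right, hB.smul_right, hB.mem_perp.1 p.2.2, add_zero, mul_div_cancel_right₀ _ hv]
    ext
    · exact h1
    · simp [h1]
  right_inv x := by simp

lemma splitEquiv_apply (hB : IsHermitianForm q B) {v : V} (hv : B v v ≠ 0)
    (p : K × hB.perp v) : hB.splitEquiv hv p = p.1 • v + p.2 := rfl

lemma add_left (hK : IsQuadraticField K q) (hB : IsHermitianForm q B) (x y z : V) :
    B (x + y) z = B x z + B y z := by
  rw [← hB.conj, hB.add_right, hK.add_pow, hB.conj, hB.conj]

lemma finrank_radical_perp (hK : IsQuadraticField K q) (hB : IsHermitianForm q B)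
    {v : V} (hv : B v v ≠ 0) :
    Module.finrank K (hB.restrict (hB.perp v)).radical = Module.finrank K hB.radical := by
  have h : (hB.restrict (hB.perp v)).radical.map (hB.perp v).subtype = hB.radical := by
    ext x
    constructor
    · rintro ⟨u, hu, rfl⟩ y
      obtain ⟨p, rfl⟩ := (hB.splitEquiv hv).surjective y
      rw [splitEquiv_apply, hB.add_left hK, hB.smul_left]
      have h1 : B v u = 0 := u.2
      have h2 : B p.2 u = 0 := hu p.2
      simp [h1, h2]
    · intro hx
      exact ⟨⟨x, hx v⟩, fun y => hx y, rfl⟩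
  rw [← h, Submodule.finrank_map_subtype_eq]

variable [Finite K]

lemma symm_zero (hK : IsQuadraticField K q) (hB : IsHermitianForm q B) {x y : V}
    (h : B x y = 0) : B y x = 0 := by
  rw [← hB.conj, h, hK.zero_pow]

/-- A Hermitian form with only isotropic vectors is zero. -/
lemma eq_zero_of_forall_self (hK : IsQuadraticField K q) (hB : IsHermitianForm q B)
    (h : ∀ x, B x x = 0) (x y : V) : B x y = 0 := by
  by_contra hxy
  obtain ⟨d, hd⟩ := hK.exists_add_pow_ne_zero
  set c := d * (B x y)⁻¹
  have hc : B x (c • y) = d := by rw [hB.smul_right, inv_mul_cancel_right₀ hxy]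
  have h1 := h (x + c • y)
  rw [hB.add_right, hB.add_left hK, hB.add_left hK, h, h, ← hB.conj x, hc, zero_add, add_zero,
    add_comm] at h1
  exact hd h1

lemma card_isotropic_split (hK : IsQuadraticField K q) (hB : IsHermitianForm q B) [Finite V]
    {v : V} (hv : B v v ≠ 0) :
    (Nat.card {x : V // B x x = 0} : ℝ) = (q + 1) * Nat.card (hB.perp v) -
      q * Nat.card {u : hB.perp v // B u u = 0} := by
  classical
  have := Fintype.ofFinite (hB.perp v)
  set U := hB.perp v with hU
  have e : {x : V // B x x = 0} ≃ Σ u : U, {s : K // B v v * s ^ (q + 1) + B u u = 0} := by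
    let e₁ : U × K ≃ V := (Equiv.prodComm U K).trans (hB.splitEquiv hv).toEquiv
    refine (e₁.subtypeEquivOfSubtype (p := fun x => B x x = 0)).symm.trans
      (Equiv.trans (Equiv.subtypeEquivRight fun p => ?_)
        (Equiv.subtypeProdEquivSigmaSubtype fun (u : U) (s : K) =>
          B v v * s ^ (q + 1) + B u u = 0))
    have h1 : B v p.1 = 0 := p.1.2
    have h2 : B p.1 v = 0 := hB.symm_zero hK h1
    have h3 : e₁ p = p.2 • v + p.1 := rfl
    rw [h3, hB.add_right, hB.smul_right, hB.add_left hK, hB.add_left hK, hB.smul_left,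
      hB.smul_left, h1, h2]
    ring_nf
  -- Over an isotropic `u` only `s = 0` occurs, otherwise `s` has a prescribed nonzero norm.
  have hfib (u : U) : (Nat.card {s : K // B v v * s ^ (q + 1) + B u u = 0} : ℝ) =
      (q + 1) - q * if B u u = 0 then 1 else 0 := by
    split_ifs with hu
    · have : Unique {s : K // B v v * s ^ (q + 1) + B u u = 0} :=
        { default := ⟨0, by simp [hu]⟩
          uniq := fun ⟨s, hs⟩ => by
            rw [hu, add_zero, mul_eq_zero, or_iff_right hv, pow_eq_zero_iff (Nat.succ_ne_zero q)]
              at hs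
            exact Subtype.ext hs }
      rw [Nat.card_unique]
      push_cast
      ring
    · have ht0 : -B u u / B v v ≠ 0 := div_ne_zero (neg_ne_zero.2 hu) hv
      have ht : (-B u u / B v v) ^ q = -B u u / B v v := by
        rw [div_pow, hK.neg_pow, hB.conj, hB.conj]
      rw [← Nat.card_congr (Equiv.subtypeEquivRight fun s => ?_), hK.card_norm_eq ht0 ht]
      · push_cast
        ring
      · rw [eq_div_iff hv, eq_neg_iff_add_eq_zero, mul_comm]
  have hcard : (Nat.card {u : U // B u u = 0} : ℝ) = ∑ u : U, if B u u = 0 then (1 : ℝ) else 0 := by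
    rw [Nat.card_eq_fintype_card, Fintype.card_subtype, Finset.sum_boole]
  rw [Nat.card_congr e, Nat.card_sigma, Nat.cast_sum, Finset.sum_congr rfl fun u _ => hfib u,
    Finset.sum_sub_distrib, ← Finset.mul_sum, ← hcard, Finset.sum_const, Finset.card_univ,
    ← Nat.card_eq_fintype_card, nsmul_eq_mul, mul_comm]

/-- The number of isotropic vectors of a Hermitian form on a space of dimension `n`, multiplied by
`q` to avoid the exponent `2 n - 1`; only the dimension of the radical enters besides `n`. -/
theorem card_isotropic (hK : IsQuadraticField K q) : ∀ (n : ℕ) {V : Type*} [AddCommGroup V]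
    [Module K V] [Finite V] {B : V → V → K} (hB : IsHermitianForm q B),
    Module.finrank K V = n →
    (q : ℝ) * Nat.card {x : V // B x x = 0} =
      q ^ (2 * n) + (-1) ^ (n + Module.finrank K hB.radical) * (q - 1) *
        q ^ (n + Module.finrank K hB.radical) := by
  intro n
  induction n with
  | zero =>
    intro V _ _ _ B hB hn
    have : Subsingleton V := Module.finrank_zero_iff.1 hn
    have hk : Module.finrank K hB.radical = 0 := Module.finrank_zero_of_subsingleton
    have : Unique {x : V // B x x = 0} :=
      { default := ⟨0, hB.zero_right 0⟩, uniq := fun _ => Subsingleton.elim _ _ }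
    rw [hk, Nat.card_unique]
    norm_num
  | succ n ih =>
    intro V _ _ _ B hB hn
    by_cases h : ∀ x, B x x = 0
    · have htop : hB.radical = ⊤ :=
        eq_top_iff.2 fun x _ y => hB.eq_zero_of_forall_self hK h y x
      have hc : Nat.card {x : V // B x x = 0} = q ^ (2 * (n + 1)) := by
        rw [Nat.card_congr (Equiv.subtypeUnivEquiv h), Module.natCard_eq_pow_finrank (K := K), hn,
          hK.card, ← pow_mul]
      rw [htop, finrank_top, hn, hc, Even.neg_one_pow ⟨n + 1, rfl⟩]
      push_cast
      ring
    · push Not at h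
      obtain ⟨v, hv⟩ := h
      have hdim : Module.finrank K (hB.perp v) = n := by
        have := (hB.splitEquiv hv).finrank_eq
        rw [Module.finrank_prod, Module.finrank_self, hn] at this
        omega
      have hc : (Nat.card (hB.perp v) : ℝ) = q ^ (2 * n) := by
        rw [Module.natCard_eq_pow_finrank (K := K), hdim, hK.card, ← pow_mul]
        push_cast
        rfl
      have h1 := ih (hB.restrict (hB.perp v)) hdim
      rw [hB.finrank_radical_perp hK hv] at h1
      rw [hB.card_isotropic_split hK hv, hc, mul_sub, h1]
      ring

/-- The count of anisotropic vectors, with the rank `r` in place of the dimension of the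
radical. -/
lemma card_anisotropic (hK : IsQuadraticField K q) {V : Type*} [AddCommGroup V]
    [Module K V] [Finite V] {B : V → V → K} (hB : IsHermitianForm q B) {n r : ℕ}
    (hn : Module.finrank K V = n) (hr : Module.finrank K hB.radical + r = n) :
    (q : ℝ) ^ (r + 1) * Nat.card {x : V // B x x ≠ 0} =
      (q - 1) * q ^ (2 * n) * (q ^ r - (-1) ^ r) := by
  classical
  have := Fintype.ofFinite V
  have h := hB.card_isotropic hK n hn
  have hc : (Nat.card {x : V // B x x ≠ 0} : ℝ) =
      q ^ (2 * n) - Nat.card {x : V // B x x = 0} := by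
    rw [eq_sub_iff_add_eq]
    have h1 : Nat.card V = q ^ (2 * n) := by
      rw [Module.natCard_eq_pow_finrank (K := K), hn, hK.card, ← pow_mul]
    have h2 : Nat.card {x : V // B x x ≠ 0} + Nat.card {x : V // B x x = 0} = Nat.card V := by
      rw [add_comm, ← Nat.card_sum]
      exact Nat.card_congr (Equiv.sumCompl _)
    rw [h1] at h2
    exact_mod_cast h2
  set k := Module.finrank K hB.radical
  subst hr
  have e1 : (-1 : ℝ) ^ (k + r + k) = (-1) ^ r := by
    rw [show k + r + k = 2 * k + r by ring, pow_add, pow_mul]; norm_num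
  rw [e1] at h
  rw [hc]
  linear_combination (-(q : ℝ) ^ r) * h

end IsHermitianForm

/-! ### Self-adjoint square-zero endomorphisms -/

/-- `N` is self-adjoint with respect to `B` and has square zero. -/
structure IsSqZeroSelfAdjoint {K V : Type*} [Field K] [AddCommGroup V] [Module K V]
    (B : V → V → K) (N : V →ₗ[K] V) : Prop where
  sq_zero : ∀ x, N (N x) = 0
  self_adjoint : ∀ x y, B (N x) y = B x (N y)

/-- The self-adjoint square-zero endomorphisms of rank `r`. -/
abbrev SqZeroOfRank {K V : Type*} [Field K] [AddCommGroup V] [Module K V]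
    (B : V → V → K) (r : ℕ) : Type _ :=
  {N : V →ₗ[K] V // IsSqZeroSelfAdjoint B N ∧ Module.finrank K (LinearMap.range N) = r}

namespace IsHermitianForm

variable {K V : Type*} [Field K] [AddCommGroup V] [Module K V] {q : ℕ} {B : V → V → K}

lemma comp_selfAdjoint (hB : IsHermitianForm q B) {N : V →ₗ[K] V}
    (hN : ∀ x y, B (N x) y = B x (N y)) : IsHermitianForm q fun x y => B x (N y) where
  add_right x y z := by rw [map_add, hB.add_right]
  smul_right x a y := by rw [map_smul, hB.smul_right]
  conj x y := by rw [hB.conj, hN]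

lemma radical_comp_selfAdjoint (hB : IsHermitianForm q B) (hnd : hB.radical = ⊥) {N : V →ₗ[K] V}
    (hN : ∀ x y, B (N x) y = B x (N y)) :
    (hB.comp_selfAdjoint hN).radical = LinearMap.ker N := by
  ext x
  rw [LinearMap.mem_ker, ← Submodule.mem_bot K, ← hnd]
  rfl

section Hyperbolic

variable (hB : IsHermitianForm q B)

/-- The orthogonal complement of a pair of vectors. -/
def perp₂ (v w : V) : Submodule K V := hB.perp v ⊓ hB.perp w

variable {v w : V} (hw : B w w = 0) (hvw : B v w ≠ 0) (hwv : B w v = B v w)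

/-- The decomposition of the space along a nondegenerate plane with basis `v`, `w`, where `w` is
isotropic. -/
noncomputable def planeEquiv : ((K × K) × hB.perp₂ v w) ≃ₗ[K] V where
  toFun p := p.1.1 • v + p.1.2 • w + p.2
  map_add' p p' := by
    simp only [Prod.fst_add, Prod.snd_add, Submodule.coe_add, add_smul]
    abel
  map_smul' c p := by simp [mul_smul]
  invFun x := ((B w x / B v w, (B v x - B w x / B v w * B v v) / B v w),
    ⟨x - (B w x / B v w) • v - ((B v x - B w x / B v w * B v v) / B v w) • w, by
      constructor
      · change B v _ = 0
        rw [hB.sub_right, hB.sub_right, hB.smul_right, hB.smul_right]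
        field_simp
        ring
      · change B w _ = 0
        rw [hB.sub_right, hB.sub_right, hB.smul_right, hB.smul_right, hw, hwv]
        field_simp
        ring⟩)
  left_inv p := by
    have h1 : B v p.2 = 0 := p.2.2.1
    have h2 : B w p.2 = 0 := p.2.2.2
    have h3 : B w (p.1.1 • v + p.1.2 • w + p.2) / B v w = p.1.1 := by
      rw [hB.add_right, hB.add_right, hB.smul_right, hB.smul_right, h2, hw, hwv]
      field_simp
      ring
    have h4 : (B v (p.1.1 • v + p.1.2 • w + p.2) - p.1.1 * B v v) / B v w = p.1.2 := by
      rw [hB.add_right, hB.add_right, hB.smul_right, hB.smul_right, h1]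
      field_simp
      ring
    ext
    · exact h3
    · simp only [h3, h4]
    · simp only [h3, h4]
      abel
  right_inv x := by
    simp only
    abel

lemma planeEquiv_apply (p : (K × K) × hB.perp₂ v w) :
    hB.planeEquiv hw hvw hwv p = p.1.1 • v + p.1.2 • w + p.2 := rfl

/-- The extension of an endomorphism of `⟨v, w⟩ᗮ` that maps `v` to `w` and `w` to `0`. -/
noncomputable def extendPlane (N : hB.perp₂ v w →ₗ[K] hB.perp₂ v w) : V →ₗ[K] V :=
  (LinearMap.toSpanSingleton K V w ∘ₗ LinearMap.fst K K K ∘ₗ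
      LinearMap.fst K (K × K) (hB.perp₂ v w) +
    (hB.perp₂ v w).subtype ∘ₗ N ∘ₗ LinearMap.snd K (K × K) (hB.perp₂ v w)) ∘ₗ
    (hB.planeEquiv hw hvw hwv).symm.toLinearMap

lemma extendPlane_apply (N : hB.perp₂ v w →ₗ[K] hB.perp₂ v w) (p : (K × K) × hB.perp₂ v w) :
    hB.extendPlane hw hvw hwv N (p.1.1 • v + p.1.2 • w + p.2) = p.1.1 • w + N p.2 := by
  rw [← hB.planeEquiv_apply hw hvw hwv]
  simp [extendPlane]

lemma extendPlane_left (N : hB.perp₂ v w →ₗ[K] hB.perp₂ v w) :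
    hB.extendPlane hw hvw hwv N v = w := by
  simpa using hB.extendPlane_apply hw hvw hwv N ((1, 0), 0)

lemma extendPlane_right (N : hB.perp₂ v w →ₗ[K] hB.perp₂ v w) :
    hB.extendPlane hw hvw hwv N w = 0 := by
  simpa using hB.extendPlane_apply hw hvw hwv N ((0, 1), 0)

lemma extendPlane_coe (N : hB.perp₂ v w →ₗ[K] hB.perp₂ v w) (u : hB.perp₂ v w) :
    hB.extendPlane hw hvw hwv N u = N u := by
  simpa using hB.extendPlane_apply hw hvw hwv N ((0, 0), u)

lemma finrank_range_extendPlane [FiniteDimensional K V]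
    (N : hB.perp₂ v w →ₗ[K] hB.perp₂ v w) :
    Module.finrank K (LinearMap.range (hB.extendPlane hw hvw hwv N)) =
      Module.finrank K (LinearMap.range N) + 1 := by
  let g : (K × LinearMap.range N) →ₗ[K] V :=
    LinearMap.coprod (LinearMap.toSpanSingleton K V w)
      ((hB.perp₂ v w).subtype ∘ₗ (LinearMap.range N).subtype)
  have hg (p : K × LinearMap.range N) : g p = p.1 • w + (p.2 : hB.perp₂ v w) := by
    simp [g]
  have hinj : Function.Injective g := by
    intro p p' h
    rw [hg, hg] at h
    have h1 : hB.planeEquiv hw hvw hwv ((0, p.1), p.2) =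
        hB.planeEquiv hw hvw hwv ((0, p'.1), p'.2) := by
      simpa [planeEquiv_apply] using h
    have h2 := (hB.planeEquiv hw hvw hwv).injective h1
    simp only [Prod.mk.injEq, true_and] at h2
    exact Prod.ext h2.1 (Subtype.ext h2.2)
  have hrange : LinearMap.range (hB.extendPlane hw hvw hwv N) = LinearMap.range g := by
    ext x
    constructor
    · rintro ⟨y, rfl⟩
      obtain ⟨p, rfl⟩ := (hB.planeEquiv hw hvw hwv).surjective y
      exact ⟨(p.1.1, ⟨N p.2, p.2, rfl⟩), by
        rw [hg, planeEquiv_apply, extendPlane_apply]⟩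
    · rintro ⟨⟨s, _, u, rfl⟩, rfl⟩
      exact ⟨_, (hB.extendPlane_apply hw hvw hwv N ((s, 0), u)).trans (hg (s, ⟨N u, u, rfl⟩)).symm⟩
  rw [hrange, LinearMap.finrank_range_of_inj hinj, Module.finrank_prod, Module.finrank_self,
    add_comm]

include hw hvw hwv in
lemma radical_perp₂ (hK : IsQuadraticField K q) (hnd : hB.radical = ⊥) :
    (hB.restrict (hB.perp₂ v w)).radical = ⊥ := by
  refine eq_bot_iff.2 fun u hu => ?_
  have h : (u : V) ∈ hB.radical := by
    intro y
    obtain ⟨p, rfl⟩ := (hB.planeEquiv hw hvw hwv).surjective y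
    have hv0 : B v u = 0 := u.2.1
    have hw0 : B w u = 0 := u.2.2
    have h2 : B p.2 u = 0 := hu p.2
    rw [planeEquiv_apply, hB.add_left hK, hB.add_left hK, hB.smul_left, hB.smul_left, hv0, hw0, h2]
    simp
  rw [hnd, Submodule.mem_bot] at h
  exact (Submodule.mem_bot K).2 (Subtype.ext h)

include hw hvw hwv in
lemma finrank_perp₂ [FiniteDimensional K V] :
    Module.finrank K V = Module.finrank K (hB.perp₂ v w) + 2 := by
  rw [← (hB.planeEquiv hw hvw hwv).finrank_eq, Module.finrank_prod, Module.finrank_prod,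
    Module.finrank_self, add_comm]

variable [Finite K]

lemma isSqZeroSelfAdjoint_extendPlane (hK : IsQuadraticField K q)
    {N : hB.perp₂ v w →ₗ[K] hB.perp₂ v w}
    (hN : IsSqZeroSelfAdjoint (fun x y : hB.perp₂ v w => B x y) N) :
    IsSqZeroSelfAdjoint B (hB.extendPlane hw hvw hwv N) where
  sq_zero x := by
    obtain ⟨p, rfl⟩ := (hB.planeEquiv hw hvw hwv).surjective x
    rw [planeEquiv_apply, extendPlane_apply, map_add, map_smul, extendPlane_right,
      extendPlane_coe, hN.sq_zero]
    simp
  self_adjoint x y := by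
    obtain ⟨p, rfl⟩ := (hB.planeEquiv hw hvw hwv).surjective x
    obtain ⟨p', rfl⟩ := (hB.planeEquiv hw hvw hwv).surjective y
    simp only [planeEquiv_apply, extendPlane_apply]
    have hv0 (u : hB.perp₂ v w) : B v u = 0 := u.2.1
    have hw0 (u : hB.perp₂ v w) : B w u = 0 := u.2.2
    have h1 := hN.self_adjoint p.2 p'.2
    simp only [hB.add_right, hB.add_left hK, hB.smul_right, hB.smul_left, hv0, hw0, hw, hwv,
      hB.symm_zero hK (hv0 _), hB.symm_zero hK (hw0 _), h1]
    ring

include hw hvw hwv in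
/-- The self-adjoint square-zero endomorphisms that map `v` to `w` are the extensions of those of
`⟨v, w⟩ᗮ`. -/
lemma card_sqZeroOfRank_apply_eq [FiniteDimensional K V] (hK : IsQuadraticField K q) (r : ℕ) :
    Nat.card {N : SqZeroOfRank B (r + 1) // N.1 v = w} =
      Nat.card (SqZeroOfRank (fun x y : hB.perp₂ v w => B x y) r) := by
  let f : SqZeroOfRank (fun x y : hB.perp₂ v w => B x y) r →
      {N : SqZeroOfRank B (r + 1) // N.1 v = w} := fun N =>
    ⟨⟨hB.extendPlane hw hvw hwv N.1,
      hB.isSqZeroSelfAdjoint_extendPlane hw hvw hwv hK N.2.1, by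
        rw [finrank_range_extendPlane, N.2.2]⟩, hB.extendPlane_left hw hvw hwv N.1⟩
  refine (Nat.card_congr (Equiv.ofBijective f ⟨fun N N' h => ?_, fun N => ?_⟩)).symm
  · have h1 : hB.extendPlane hw hvw hwv N.1 = hB.extendPlane hw hvw hwv N'.1 :=
      congrArg (fun M => M.1.1) h
    refine Subtype.ext (LinearMap.ext fun u => Subtype.ext ?_)
    rw [← hB.extendPlane_coe hw hvw hwv N.1, h1, extendPlane_coe]
  · obtain ⟨⟨N, hN, hr⟩, hNv⟩ := N
    change N v = w at hNv
    have hNw : N w = 0 := by rw [← hNv, hN.sq_zero]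
    have hstab : ∀ u ∈ hB.perp₂ v w, N u ∈ hB.perp₂ v w := by
      intro u hu
      constructor
      · change B v (N u) = 0
        rw [← hN.self_adjoint, hNv]
        exact hu.2
      · change B w (N u) = 0
        rw [← hN.self_adjoint, hNw, ← zero_smul K w, hB.smul_left, hK.zero_pow, zero_mul]
    have hext : hB.extendPlane hw hvw hwv (N.restrict hstab) = N := by
      ext x
      obtain ⟨p, rfl⟩ := (hB.planeEquiv hw hvw hwv).surjective x
      rw [planeEquiv_apply, extendPlane_apply, map_add, map_add, map_smul, map_smul, hNv, hNw]
      simp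
    refine ⟨⟨N.restrict hstab, ⟨fun x => Subtype.ext (hN.sq_zero x),
      fun x y => hN.self_adjoint x y⟩, ?_⟩, Subtype.ext (Subtype.ext hext)⟩
    have := hB.finrank_range_extendPlane hw hvw hwv (N.restrict hstab)
    rw [hext, hr] at this
    omega

end Hyperbolic

end IsHermitianForm

/-! ### The number of self-adjoint square-zero endomorphisms -/

instance {K V : Type*} [Field K] [AddCommGroup V] [Module K V] [Finite V] (B : V → V → K)
    (r : ℕ) : Finite (SqZeroOfRank B r) :=
  have : Finite (V →ₗ[K] V) := DFunLike.finite _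
  Subtype.finite

lemma card_fiber_mul_card {K V : Type*} [Field K] [Finite K] [AddCommGroup V] [Module K V]
    [Finite V] {φ : V →ₗ[K] K} (hφ : φ ≠ 0) (a : K) :
    Nat.card K * Nat.card {v // φ v = a} = Nat.card V := by
  refine (card_eq_mul_of_fiber φ _ fun b => ?_).symm
  obtain ⟨u, hu⟩ := LinearMap.surjective hφ (a - b)
  refine Nat.card_congr ((Equiv.addRight u).subtypeEquiv fun v => ?_)
  rw [Equiv.coe_addRight, map_add, hu, ← sub_eq_zero, ← sub_eq_zero (b := a)]
  ring_nf

namespace IsHermitianForm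

variable {K V : Type*} [Field K] [AddCommGroup V] [Module K V] {q : ℕ} {B : V → V → K}
variable [Finite K] [Finite V]

/-- The pairs `(v, w)` that can occur as `(v, N v)` with `B v (N v) ≠ 0`, for a self-adjoint
square-zero `N`. -/
abbrev PlanePair (B : V → V → K) : Type _ :=
  {p : V × V // B p.2 p.2 = 0 ∧ B p.1 p.2 ≠ 0 ∧ B p.2 p.1 = B p.1 p.2}

lemma card_planePair (hK : IsQuadraticField K q) (hB : IsHermitianForm q B)
    (hnd : hB.radical = ⊥) {n : ℕ} (hn : Module.finrank K V = n + 1) :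
    Nat.card (PlanePair B) =
      Nat.card {w : V // w ≠ 0 ∧ B w w = 0} * (q - 1) * q ^ (2 * n) := by
  rw [← hK.card_fixed, ← Nat.card_prod]
  let f : PlanePair B → {w : V // w ≠ 0 ∧ B w w = 0} × {a : K // a ≠ 0 ∧ a ^ q = a} := fun p =>
    (⟨p.1.2, fun h => p.2.2.1 (by rw [h, hB.zero_right]), p.2.1⟩,
      ⟨B p.1.1 p.1.2, p.2.2.1, by rw [hB.conj, p.2.2.2]⟩)
  refine card_eq_mul_of_fiber f _ fun b => ?_
  obtain ⟨⟨w, hw0, hw⟩, ⟨a, ha0, ha⟩⟩ := b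
  have hφ : hB.toDual w ≠ 0 := by
    intro h
    have hw' : w ∈ hB.radical := fun y => hB.symm_zero hK (LinearMap.congr_fun h y)
    rw [hnd] at hw'
    exact hw0 hw'
  have h := card_fiber_mul_card hφ a
  rw [Module.natCard_eq_pow_finrank (K := K) (V := V), hn, hK.card, ← pow_mul,
    mul_add, pow_add, mul_comm, mul_one] at h
  have hq := hK.one_lt
  rw [← Nat.eq_of_mul_eq_mul_right (by positivity) h]
  have hto (v : V) (hv : B w v = a) : B v w = a := by rw [← hB.conj, hv, ha]
  exact Nat.card_congr
    { toFun := fun p => ⟨p.1.1.1, by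
        have h1 : p.1.1.2 = w := congrArg (fun x => x.1.1) p.2
        have h2 : B p.1.1.1 p.1.1.2 = a := congrArg (fun x => x.2.1) p.2
        have h3 : B w p.1.1.1 = B p.1.1.2 p.1.1.1 := by rw [h1]
        exact h3.trans (p.1.2.2.2.trans h2)⟩
      invFun := fun v => ⟨⟨(v.1, w), hw, (hto v.1 v.2).symm ▸ ha0, v.2.trans (hto v.1 v.2).symm⟩,
        Prod.ext rfl (Subtype.ext (hto v.1 v.2))⟩
      left_inv := fun p => by
        have h1 : p.1.1.2 = w := congrArg (fun x => x.1.1) p.2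
        exact Subtype.ext (Subtype.ext (Prod.ext rfl h1.symm))
      right_inv := fun v => rfl }

lemma card_isotropic_ne_zero (hK : IsQuadraticField K q) (hB : IsHermitianForm q B)
    (hnd : hB.radical = ⊥) {n : ℕ} (hn : Module.finrank K V = n + 1) :
    (Nat.card {w : V // w ≠ 0 ∧ B w w = 0} : ℝ) =
      (q ^ (n + 1) - (-1) ^ (n + 1)) * (q ^ n - (-1) ^ n) := by
  classical
  have := Fintype.ofFinite V
  have h := hB.card_isotropic hK _ hn
  have hq := hK.one_lt
  have hc : Nat.card {w : V // B w w = 0} = Nat.card {w : V // w ≠ 0 ∧ B w w = 0} + 1 := by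
    simp only [Nat.card_eq_fintype_card, Fintype.card_subtype]
    rw [← Finset.card_erase_add_one (a := (0 : V)) (by simp [hB.zero_right])]
    congr 2
    ext w
    simp
  rw [hc, hnd, finrank_bot] at h
  have hq0 : (q : ℝ) ≠ 0 := by positivity
  apply mul_left_cancel₀ hq0
  have e : ((-1 : ℝ) ^ n) * (-1) ^ n = 1 := by rw [← mul_pow]; norm_num
  push_cast at h
  simp only [add_zero] at h
  rw [pow_succ (-1 : ℝ)] at h ⊢
  linear_combination h + q * e

/-- Double counting of the pairs `(N, v)` with `B v (N v) ≠ 0`: for given `N` these `v` are the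
anisotropic vectors of a form of rank `r + 1`. -/
lemma card_pairs_eq (hK : IsQuadraticField K q) (hB : IsHermitianForm q B)
    (hnd : hB.radical = ⊥) (r : ℕ) :
    (q : ℝ) ^ (r + 2) *
        Nat.card {p : SqZeroOfRank B (r + 1) × V // B p.2 (p.1.1 p.2) ≠ 0} =
      Nat.card (SqZeroOfRank B (r + 1)) * ((q - 1) * q ^ (2 * Module.finrank K V) *
        (q ^ (r + 1) - (-1) ^ (r + 1))) := by
  have := Fintype.ofFinite (SqZeroOfRank B (r + 1))
  rw [Nat.card_congr (Equiv.subtypeProdEquivSigmaSubtype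
    fun (N : SqZeroOfRank B (r + 1)) (v : V) => B v (N.1 v) ≠ 0), Nat.card_sigma, Nat.cast_sum,
    Finset.mul_sum, Finset.sum_congr rfl fun N _ => ?_, Finset.sum_const, nsmul_eq_mul,
    Finset.card_univ, ← Nat.card_eq_fintype_card]
  refine (hB.comp_selfAdjoint N.2.1.self_adjoint).card_anisotropic hK rfl ?_
  have hr : Module.finrank K (LinearMap.range N.1) = r + 1 := N.2.2
  have hk := LinearMap.finrank_range_add_finrank_ker N.1
  rw [hB.radical_comp_selfAdjoint hnd N.2.1.self_adjoint]
  omega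

/-- The number of self-adjoint square-zero endomorphisms of rank `r` of a nondegenerate Hermitian
space. -/
theorem card_sqZeroOfRank (hK : IsQuadraticField K q) (r : ℕ) :
    ∀ {V : Type*} [AddCommGroup V] [Module K V] [Finite V] {B : V → V → K}
      (hB : IsHermitianForm q B), hB.radical = ⊥ →
    (Nat.card (SqZeroOfRank B r) : ℝ) = sqZeroCount q (Module.finrank K V) r := by
  have hq := hK.one_lt
  have hq1 : 1 < (q : ℝ) := by exact_mod_cast hq
  induction r with
  | zero =>
    intro V _ _ _ B hB _
    have : Unique (SqZeroOfRank B 0) :=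
      { default := ⟨0, ⟨fun _ => rfl, fun x y => by
          rw [LinearMap.zero_apply, LinearMap.zero_apply, hB.zero_right,
            hB.symm_zero hK (hB.zero_right y)]⟩, by rw [LinearMap.range_zero, finrank_bot]⟩
        uniq := fun N => Subtype.ext <| LinearMap.range_eq_bot.1 <|
          Submodule.finrank_eq_zero.1 N.2.2 }
    rw [Nat.card_unique, sqZeroCount_zero, Nat.cast_one]
  | succ r ih =>
    intro V _ _ _ B hB hnd
    have := Fintype.ofFinite (PlanePair B)
    have h1 := hB.card_pairs_eq hK hnd r
    -- The second count of the pairs is by the value of `(v, N v)`.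
    let f : {p : SqZeroOfRank B (r + 1) × V // B p.2 (p.1.1 p.2) ≠ 0} → PlanePair B := fun p =>
      ⟨(p.1.2, p.1.1.1 p.1.2), by
        rw [p.1.1.2.1.self_adjoint, p.1.1.2.1.sq_zero, hB.zero_right], p.2,
        p.1.1.2.1.self_adjoint _ _⟩
    have hfib (b : PlanePair B) : (Nat.card {p // f p = b} : ℝ) =
        sqZeroCount q (Module.finrank K V - 2) r := by
      obtain ⟨⟨v, w⟩, hw, hvw, hwv⟩ := b
      have hdim := hB.finrank_perp₂ hw hvw hwv
      rw [hdim, Nat.add_sub_cancel, ← ih _ (hB.radical_perp₂ hw hvw hwv hK hnd),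
        ← hB.card_sqZeroOfRank_apply_eq hw hvw hwv hK]
      congr 1
      exact Nat.card_congr
        { toFun := fun p => ⟨p.1.1.1, by
            have h1 : p.1.1.2 = v := congrArg (fun x => x.1.1) p.2
            have h2 : p.1.1.1.1 p.1.1.2 = w := congrArg (fun x => x.1.2) p.2
            exact (congrArg p.1.1.1.1 h1.symm).trans h2⟩
          invFun := fun N => ⟨⟨(N.1, v), by rw [N.2]; exact hvw⟩,
            Subtype.ext (Prod.ext rfl N.2)⟩
          left_inv := fun p => by
            have h1 : p.1.1.2 = v := congrArg (fun x => x.1.1) p.2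
            exact Subtype.ext (Subtype.ext (Prod.ext rfl h1.symm))
          right_inv := fun N => rfl }
    have h2 : (Nat.card {p : SqZeroOfRank B (r + 1) × V // B p.2 (p.1.1 p.2) ≠ 0} : ℝ) =
        Nat.card (PlanePair B) * sqZeroCount q (Module.finrank K V - 2) r := by
      rw [Nat.card_congr (Equiv.sigmaFiberEquiv f).symm, Nat.card_sigma, Nat.cast_sum,
        Finset.sum_congr rfl fun b _ => hfib b, Finset.sum_const, nsmul_eq_mul, Finset.card_univ,
        ← Nat.card_eq_fintype_card]
    have hx : (q : ℝ) ^ (r + 1) - (-1) ^ (r + 1) ≠ 0 := by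
      rw [pow_sub_neg_one_pow_eq (by positivity)]
      exact mul_ne_zero (by positivity)
        (one_sub_pow_ne_zero (abs_neg_inv_lt_one hq1) (Nat.succ_ne_zero r))
    have hq1' : (q : ℝ) - 1 ≠ 0 := sub_ne_zero.2 hq1.ne'
    have hq0 : (q : ℝ) ≠ 0 := by positivity
    rw [h2] at h1
    rw [sqZeroCount_succ, div_mul_eq_mul_div, eq_div_iff hx]
    have hc : ((q : ℝ) - 1) * q ^ (2 * Module.finrank K V) ≠ 0 :=
      mul_ne_zero hq1' (pow_ne_zero _ hq0)
    apply mul_left_cancel₀ hc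
    rcases hn : Module.finrank K V with _ | n
    · have : Subsingleton V := Module.finrank_zero_iff.1 hn
      have : IsEmpty (PlanePair B) := ⟨fun p => p.2.2.1 (by
        rw [Subsingleton.elim p.1.2 0, hB.zero_right])⟩
      rw [hn, Nat.card_of_isEmpty] at h1
      norm_num at h1 ⊢
      grind
    · rw [hn, hB.card_planePair hK hnd hn] at h1
      push_cast [hB.card_isotropic_ne_zero hK hnd hn, Nat.cast_sub hq.le] at h1
      rw [Nat.add_sub_cancel, show n + 1 - 2 = n - 1 by omega]
      linear_combination -h1

end IsHermitianForm

/-! ### Involutions of the unitary group -/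

lemma isQuadraticField_and_two_eq_zero {K : Type*} [Field K] [Finite K] {q : ℕ} (hq : Even q)
    (hK : Nat.card K = q ^ 2) : IsQuadraticField K q ∧ (2 : K) = 0 := by
  have := Fintype.ofFinite K
  obtain ⟨p, hp⟩ := CharP.exists K
  obtain ⟨m, hprime, hm⟩ := FiniteField.card K p
  rw [← Nat.card_eq_fintype_card, hK] at hm
  have h2 : 2 ∣ p ^ (m : ℕ) := hm ▸ dvd_pow hq.two_dvd two_ne_zero
  obtain rfl : 2 = p := (Nat.prime_dvd_prime_iff_eq Nat.prime_two hprime).1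
    (Nat.prime_two.dvd_of_dvd_pow h2)
  obtain ⟨k, -, rfl⟩ := (Nat.dvd_prime_pow Nat.prime_two).1 (hm ▸ dvd_pow_self q two_ne_zero)
  have : Fact (Nat.Prime 2) := ⟨Nat.prime_two⟩
  exact ⟨⟨hK, fun a b => add_pow_char_pow a b 2 k⟩, CharTwo.two_eq_zero⟩

section Involutions

variable {K : Type*} [Field K] [Finite K] {q n : ℕ} {H : Matrix (Fin n) (Fin n) K}

lemma IsQuadraticField.sum_pow (hK : IsQuadraticField K q) {ι : Type*} (s : Finset ι) (f : ι → K) :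
    (∑ i ∈ s, f i) ^ q = ∑ i ∈ s, f i ^ q :=
  map_sum (⟨⟨fun a => a ^ q, hK.zero_pow⟩, hK.add_pow⟩ : K →+ K) f s

lemma IsNondegHermitian.isHermitianForm (hK : IsQuadraticField K q) (hH : IsNondegHermitian q H) :
    IsHermitianForm q (sesqForm q H) where
  add_right x y z := by simp [sesqForm, mul_add, Finset.sum_add_distrib]
  smul_right x a y := by
    simp only [sesqForm, Finset.mul_sum, Pi.smul_apply, smul_eq_mul]
    exact Finset.sum_congr rfl fun i _ => Finset.sum_congr rfl fun j _ => by ring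
  conj x y := by
    simp only [sesqForm, hK.sum_pow, mul_pow, hK.pow_pow, hH.conj_symm]
    rw [Finset.sum_comm]
    exact Finset.sum_congr rfl fun i _ => Finset.sum_congr rfl fun j _ => by ring

lemma IsNondegHermitian.radical_eq_bot (hK : IsQuadraticField K q) (hH : IsNondegHermitian q H) :
    (hH.isHermitianForm hK).radical = ⊥ :=
  eq_bot_iff.2 fun x hx => (Submodule.mem_bot K).2 <|
    hH.nondeg x fun y => (hH.isHermitianForm hK).symm_zero hK (hx y)

/-- In characteristic two the involutions `g` of the unitary group correspond to the self-adjoint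
square-zero endomorphisms `g - 1`. -/
lemma numInvolutions_eq_card (hK : IsQuadraticField K q) (h2 : (2 : K) = 0)
    (hH : IsNondegHermitian q H) : numInvolutions (formUnitaryGroup q H) =
      Nat.card {N : (Fin n → K) →ₗ[K] (Fin n → K) // IsSqZeroSelfAdjoint (sesqForm q H) N} := by
  have hB := hH.isHermitianForm hK
  have hadd (x : Fin n → K) : x + x = 0 := by rw [← two_smul K x, h2, zero_smul]
  have haddK (a : K) : a + a = 0 := by rw [← two_mul, h2, zero_mul]
  have hinv (g : {g : formUnitaryGroup q H // g ^ 2 = 1}) (x : Fin n → K) :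
      g.1.1.1.mulVec (g.1.1.1.mulVec x) = x := by
    have h : g.1.1 ^ 2 = 1 := congrArg Subtype.val g.2
    rw [Matrix.mulVec_mulVec, ← Units.val_mul, ← sq, h, Units.val_one, Matrix.one_mulVec]
  let f (g : {g : formUnitaryGroup q H // g ^ 2 = 1}) :
      {N : (Fin n → K) →ₗ[K] (Fin n → K) // IsSqZeroSelfAdjoint (sesqForm q H) N} :=
    ⟨g.1.1.1.mulVecLin + LinearMap.id,
      { sq_zero := fun x => by
          simp only [LinearMap.add_apply, Matrix.mulVecLin_apply, LinearMap.id_apply,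
            Matrix.mulVec_add, hinv]
          rw [add_comm x, hadd]
        self_adjoint := fun x y => by
          have h1 := g.1.2 x (g.1.1.1.mulVec y)
          rw [hinv] at h1
          simp only [LinearMap.add_apply, Matrix.mulVecLin_apply, LinearMap.id_apply,
            hB.add_right, hB.add_left hK, h1] }⟩
  refine Nat.card_congr (Equiv.ofBijective f ⟨fun g g' h => ?_, fun N => ?_⟩)
  · have h1 : g.1.1.1.mulVecLin = g'.1.1.1.mulVecLin :=
      add_right_cancel (congrArg Subtype.val h)
    exact Subtype.ext (Subtype.ext (Units.ext (Matrix.mulVec_injective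
      (funext fun x => LinearMap.congr_fun h1 x))))
  · obtain ⟨N, hN⟩ := N
    set M := LinearMap.toMatrix' (N + LinearMap.id) with hM
    have hMx (x : Fin n → K) : M.mulVec x = N x + x := by
      rw [hM, LinearMap.toMatrix'_mulVec]; rfl
    have hMM : M * M = 1 := by
      refine Matrix.mulVec_injective (funext fun x => ?_)
      rw [← Matrix.mulVec_mulVec, hMx, hMx, map_add, hN.sq_zero, Matrix.one_mulVec, zero_add,
        ← add_assoc, hadd, zero_add]
    refine ⟨⟨⟨⟨M, M, hMM, hMM⟩, fun x y => ?_⟩, ?_⟩, ?_⟩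
    · change sesqForm q H (M.mulVec x) (M.mulVec y) = _
      rw [hMx, hMx, hB.add_left hK, hB.add_right, hB.add_right, hN.self_adjoint, hN.self_adjoint,
        hN.sq_zero, hB.zero_right, zero_add, ← add_assoc, haddK, zero_add]
    · refine Subtype.ext (Units.ext ?_)
      change M ^ 2 = 1
      rw [sq, hMM]
    · refine Subtype.ext (LinearMap.ext fun x => ?_)
      change M.mulVec x + x = N x
      rw [hMx, add_assoc, hadd, add_zero]

lemma numInvolutions_eq_sqZeroTotal (hK : IsQuadraticField K q) (h2 : (2 : K) = 0)
    (hH : IsNondegHermitian q H) :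
    (numInvolutions (formUnitaryGroup q H) : ℝ) = sqZeroTotal q n := by
  have hB := hH.isHermitianForm hK
  have hfin : Module.finrank K (Fin n → K) = n := Module.finrank_fin_fun K
  have : Finite ((Fin n → K) →ₗ[K] (Fin n → K)) := DFunLike.finite _
  let f (N : {N : (Fin n → K) →ₗ[K] (Fin n → K) // IsSqZeroSelfAdjoint (sesqForm q H) N}) :
      Fin (n + 1) := ⟨Module.finrank K (LinearMap.range N.1), Nat.lt_succ_of_le
        ((Submodule.finrank_le _).trans_eq hfin)⟩
  have hfib (r : Fin (n + 1)) : (Nat.card {N // f N = r} : ℝ) = sqZeroCount q n r := by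
    have h := hB.card_sqZeroOfRank hK r (hH.radical_eq_bot hK)
    rw [hfin] at h
    rw [← h, ← Nat.card_congr (Equiv.subtypeSubtypeEquivSubtypeInter _
      fun N : (Fin n → K) →ₗ[K] (Fin n → K) => Module.finrank K (LinearMap.range N) = r)]
    congr 1
    exact Nat.card_congr (Equiv.subtypeEquivRight fun N => Fin.ext_iff)
  rw [numInvolutions_eq_card hK h2 hH, Nat.card_congr (Equiv.sigmaFiberEquiv f).symm,
    Nat.card_sigma, Nat.cast_sum, Finset.sum_congr rfl fun r _ => hfib r, sqZeroTotal,
    Finset.sum_range]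

end Involutions

theorem mainTheorem3 {K : Type*} [Field K] [Finite K] (q : ℕ) (hq : Even q)
    (hK : Nat.card K = q ^ 2) (H : ∀ n : ℕ, Matrix (Fin n) (Fin n) K)
    (hH : ∀ n, IsNondegHermitian q (H n)) :
    (Multipliable (fun k : ℕ => limitFactor q 3 5 (k + 1)) ∧
      Tendsto
        (fun n : ℕ => (numInvolutions (formUnitaryGroup q (H n)) : ℝ) / (q : ℝ) ^ (n ^ 2 / 2))
        (atTop ⊓ 𝓟 {n | Even n})
        (𝓝 (∏' k : ℕ, limitFactor q 3 5 (k + 1)))) ∧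
    (Multipliable (fun k : ℕ => limitFactor q 1 7 (k + 1)) ∧
      Tendsto
        (fun n : ℕ => (numInvolutions (formUnitaryGroup q (H n)) : ℝ) / (q : ℝ) ^ ((n ^ 2 - 1) / 2))
        (atTop ⊓ 𝓟 {n | Odd n})
        (𝓝 (∏' k : ℕ, limitFactor q 1 7 (k + 1)))) := by
  obtain ⟨hK', h2⟩ := isQuadraticField_and_two_eq_zero hq hK
  have hnum (n : ℕ) := numInvolutions_eq_sqZeroTotal hK' h2 (hH n)
  simp only [hnum]
  have h1 := (hasProd_limitFactor hK'.one_lt (a := 5) (b := 3) (by decide) (by decide)).multipliable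
  have h2 := (hasProd_limitFactor hK'.one_lt (a := 7) (b := 1) (by decide) (by decide)).multipliable
  norm_num at h1 h2
  exact ⟨⟨h1, tendsto_sqZeroTotal_even hK'.one_lt⟩, h2, tendsto_sqZeroTotal_odd hK'.one_lt⟩
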